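/- **Languages.** Let $\mathcal L_0$ be the propositional language over variables $p_0,p_1,\dots$ with $\bot,\land,\lor,\to$ (and $\neg\varphi:=\varphi\to\bot$; an empty conjunction is $\bot\to\bot$), and let $\mathcal L_\Box$ be its extension by a modality $\Box$. Justification terms are $t::=x_i\mid c_i\mid [t+t]\mid[t\cdot t]\mid\,!t$ $(i\in\mathbb N)$, with justification variables $x_i$ and justification constants $c_i$, and $\mathcal L_J$ extends $\mathcal L_0$ by formulas $t:\varphi$ for all terms $t$. **Propositional logics.** $\mathbf{IPC}$ is intuitionistic propositional logic. For sets of formulas, $\Gamma+\Delta$ is the closure of $\Gamma\cup\Delta$ under modus ponens, and a scheme stands for the set of all its instances. Put $\mathbf G:=\mathbf{IPC}+\{(\varphi\to\psi)\lor(\psi\to\varphi)\}$, for $n\ge2$ $$\mathbf{G_n}:=\mathbf G+\Big\{\bigvee_{i=0}^{n-1}\Big(\bigwedge_{j<i}\varphi_j\to\varphi_i\Big)\Big\},\qquad \mathbf{KC}:=\mathbf{IPC}+\{\neg\neg\varphi\lor\neg\varphi\}.$$ **Justification logics.** For an intermediate logic $\mathbf L$ let $\overline{\mathbf L}\subseteq\mathcal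 L_J$ be the set of all substitution instances of members of $\mathbf L$ by $\mathcal L_J$-formulas. Consider the schemes $(J)$ $t:(\varphi\to\psi)\to(s:\varphi\to[t\cdot s]:\psi)$; $(+)$ $t:\varphi\to[t+s]:\varphi$ and $t:\varphi\to[s+t]:\varphi$; $(F)$ $t:\varphi\to\varphi$; $(I)$ $t:\varphi\to\,!t:t:\varphi$. The axioms of $\mathbf{LJ}$ are $\overline{\mathbf L}\cup(J)\cup(+)$; those of $\mathbf{LJT}$, $\mathbf{LJ4}$, $\mathbf{LJT4}$ contain in addition $(F)$, $(I)$, and both $(F)$ and $(I)$, respectively. If $A$ is the set of axioms of one of these logics, its total constant specification consists of all $c_{i_m}:\dots:c_{i_1}:\alpha$ with $m\ge1$ and $\alpha\in A$; the logic proves $\psi$ if for finitely many members $\gamma_1,\dots,\gamma_k$ $(k\ge0)$ of it, $(\gamma_1\land\dots\land\gamma_k)\to\psi$ is derivable from $A$ by modus ponens. **Modal logics.** For $\Gamma,\Delta\subseteq\mathcal L_\Box$ let $\Gamma\oplus\Delta$ be the closure of $\Gamma\cup\Delta$ under modus ponens, substitution in $\mathcal L_\Box$ and necessitation. Put $\mathbf{LK}:=\mathbf{IPCK}\oplus\mathbf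 L$ with $\mathbf{IPCK}:=\mathbf{IPC}\oplus\{\Box(\varphi\to\psi)\to(\Box\varphi\to\Box\psi)\}$, $\mathbf{LT}:=\mathbf{LK}\oplus\{\Box\varphi\to\varphi\}$, $\mathbf{LK4}:=\mathbf{LK}\oplus\{\Box\varphi\to\Box\Box\varphi\}$, $\mathbf{LS4}:=\mathbf{LT}\oplus\{\Box\varphi\to\Box\Box\varphi\}$. **Realization.** A unique annotation $\varphi'$ of $\varphi\in\mathcal L_\Box$ arises by indexing the occurrences of $\Box$ in $\varphi$ with pairwise different natural numbers. Sets $\mathrm r_T(\varphi'),\mathrm r_F(\varphi')\subseteq\mathcal L_J$ are defined by recursion, for $S\in\{T,F\}$ with opposite $\bar S$: $\mathrm r_S(\varphi')=\{\varphi'\}$ if $\varphi'$ is $\bot$ or a variable; $\mathrm r_S(\varphi'\circ\psi')=\{\alpha\circ\beta\mid\alpha\in\mathrm r_S(\varphi'),\beta\in\mathrm r_S(\psi')\}$ for $\circ\in\{\land,\lor\}$; $\mathrm r_S(\varphi'\to\psi')=\{\alpha\to\beta\mid\alpha\in\mathrm r_{\bar S}(\varphi'),\beta\in\mathrm r_S(\psi')\}$;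 $\mathrm r_T(\Box_n\varphi')=\{x_n:\alpha\mid\alpha\in\mathrm r_T(\varphi')\}$; $\mathrm r_F(\Box_n\varphi')=\{t:\alpha\mid\alpha\in\mathrm r_F(\varphi'),\ t\text{ a term}\}$. A realization of $\varphi$ is an element of $\mathrm r_F(\varphi')$ for a unique annotation $\varphi'$ of $\varphi$. A justification logic *realizes* a modal logic if every theorem $\varphi$ of the modal logic has a realization that is provable in the justification logic, and moreover, for every unique annotation $\varphi'$ of $\varphi$, such a realization exists in $\mathrm r_F(\varphi')$. **Theorem.** 1. For every $n\ge2$, the logics $\mathbf{G_nJ},\mathbf{G_nJT},\mathbf{G_nJ4},\mathbf{G_nJT4}$ realize $\mathbf{G_nK},\mathbf{G_nT},\mathbf{G_nK4},\mathbf{G_nS4}$, respectively. 2. The logics $\mathbf{KCJ},\mathbf{KCJT},\mathbf{KCJ4},\mathbf{KCJT4}$ realize $\mathbf{KCK},\mathbf{KCT},\mathbf{KCK4},\mathbf{KCS4}$, respectively. -/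

import Mathlib

namespace InterJust

/-- Formulas over the variables `p_0, p_1, …` built from `⊥, ∧, ∨, →` and one unary modality
for every element of `M`. -/
inductive Form (M : Type) : Type where
  | bot : Form M
  | var : ℕ → Form M
  | and : Form M → Form M → Form M
  | or : Form M → Form M → Form M
  | imp : Form M → Form M → Form M
  | box : M → Form M → Form M

/-- Justification terms: variables `x_i`, constants `c_i`, sum, application, proof checker. -/
inductive JTerm : Type where
  | var : ℕ → JTerm
  | const : ℕ → JTerm
  | sum : JTerm → JTerm → JTerm
  | app : JTerm → JTerm → JTerm
  | bang : JTerm → JTerm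

/-- The propositional language. -/
abbrev PropForm : Type := Form Empty

/-- The justification language; `t : φ` is `Form.box t φ`. -/
abbrev JForm : Type := Form JTerm

/-- The modal language; `□ φ` is `Form.box () φ`. -/
abbrev ModalForm : Type := Form Unit

/-- The annotated modal language; `□_n φ` is `Form.box n φ`. -/
abbrev AnnForm : Type := Form ℕ

namespace Form

variable {M N : Type}

/-- Negation. -/
def neg (φ : Form M) : Form M := φ.imp bot

/-- Substitution of formulas for propositional variables. -/
def subst (σ : ℕ → Form M) : Form M → Form M
  | bot => bot
  | var p => σ p
  | and φ ψ => and (subst σ φ) (subst σ ψ)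
  | or φ ψ => or (subst σ φ) (subst σ ψ)
  | imp φ ψ => imp (subst σ φ) (subst σ ψ)
  | box m φ => box m (subst σ φ)

/-- Change of modalities along `f`. -/
def map (f : M → N) : Form M → Form N
  | bot => bot
  | var p => var p
  | and φ ψ => and (map f φ) (map f ψ)
  | or φ ψ => or (map f φ) (map f ψ)
  | imp φ ψ => imp (map f φ) (map f ψ)
  | box m φ => box (f m) (map f φ)

/-- The inclusion of the propositional language in the language with modalities `M`. -/
def ofProp (M : Type) (φ : PropForm) : Form M := φ.map Empty.elim

/-- Finite conjunctions; the empty one is `⊥ → ⊥`. -/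
def bigAnd : List (Form M) → Form M
  | [] => neg bot
  | [φ] => φ
  | φ :: ψ :: l => and φ (bigAnd (ψ :: l))

/-- Finite disjunctions; the empty one is `⊥`. -/
def bigOr : List (Form M) → Form M
  | [] => bot
  | [φ] => φ
  | φ :: ψ :: l => or φ (bigOr (ψ :: l))

/-- The list of all occurrences of modalities in a formula. -/
def modalities : Form M → List M
  | bot => []
  | var _ => []
  | and φ ψ => modalities φ ++ modalities ψ
  | or φ ψ => modalities φ ++ modalities ψ
  | imp φ ψ => modalities φ ++ modalities ψ
  | box m φ => m :: modalities φ

end Form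

open Form

/-! ### Intermediate propositional logics -/

/-- The instances of the axiom schemes of intuitionistic propositional logic. -/
inductive IntAxiom : PropForm → Prop where
  | a1 (φ ψ : PropForm) : IntAxiom (φ.imp (ψ.imp φ))
  | a2 (φ χ ψ : PropForm) :
      IntAxiom ((φ.imp (χ.imp ψ)).imp ((φ.imp χ).imp (φ.imp ψ)))
  | a3 (φ ψ : PropForm) : IntAxiom ((φ.and ψ).imp φ)
  | a4 (φ ψ : PropForm) : IntAxiom ((φ.and ψ).imp ψ)
  | a5 (φ ψ : PropForm) : IntAxiom (φ.imp (ψ.imp (φ.and ψ)))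
  | a6 (φ ψ : PropForm) : IntAxiom (φ.imp (φ.or ψ))
  | a7 (φ ψ : PropForm) : IntAxiom (ψ.imp (φ.or ψ))
  | a8 (φ ψ χ : PropForm) :
      IntAxiom ((φ.imp ψ).imp ((χ.imp ψ).imp ((φ.or χ).imp ψ)))
  | a9 (φ : PropForm) : IntAxiom (bot.imp φ)

/-- The closure of a set of formulas under modus ponens. -/
inductive MPClosure {M : Type} (Γ : Set (Form M)) : Form M → Prop where
  | base {φ : Form M} : φ ∈ Γ → MPClosure Γ φ
  | mp {φ ψ : Form M} : MPClosure Γ (φ.imp ψ) → MPClosure Γ φ → MPClosure Γ ψ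

/-- `Γ + Δ`: the smallest set that contains `Γ ∪ Δ` and is closed under modus ponens. -/
def plus {M : Type} (Γ Δ : Set (Form M)) : Set (Form M) := {φ | MPClosure (Γ ∪ Δ) φ}

/-- Intuitionistic propositional logic. -/
def IPC : Set PropForm := {φ | MPClosure {ψ | IntAxiom ψ} φ}

/-- The scheme `(φ → ψ) ∨ (ψ → φ)`. -/
def LIN : Set PropForm := {χ | ∃ φ ψ : PropForm, χ = (φ.imp ψ).or (ψ.imp φ)}

/-- The scheme `⋁_{i=0}^n (⋀_{j<i} φ_j → φ_i)`. -/
def BC (n : ℕ) : Set PropForm :=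
  {χ | ∃ f : ℕ → PropForm, χ = bigOr ((List.range (n + 1)).map fun i =>
    (bigAnd ((List.range i).map f)).imp (f i))}

/-- The scheme `¬¬φ ∨ ¬φ`. -/
def WLEM : Set PropForm := {χ | ∃ φ : PropForm, χ = φ.neg.neg.or φ.neg}

/-- Gödel–Dummett logic. -/
def G : Set PropForm := plus IPC LIN

/-- The `n`-valued Gödel logic, for `n ≥ 2`. -/
def Gn (n : ℕ) : Set PropForm := plus G (BC (n - 1))

/-- Jankov's logic. -/
def KC : Set PropForm := plus IPC WLEM

/-! ### Justification logics based on a propositional logic -/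

/-- The closure of a propositional logic under substitutions in the justification language. -/
def substClosure (L : Set PropForm) : Set JForm :=
  {χ | ∃ (φ : PropForm) (σ : ℕ → JForm), φ ∈ L ∧ χ = (ofProp JTerm φ).subst σ}

/-- The scheme `t:(φ → ψ) → (s:φ → [t·s]:ψ)`. -/
def AxJ : Set JForm :=
  {χ | ∃ (t s : JTerm) (φ ψ : JForm),
    χ = (box t (φ.imp ψ)).imp ((box s φ).imp (box (t.app s) ψ))}

/-- The schemes `t:φ → [t+s]:φ` and `t:φ → [s+t]:φ`. -/
def AxSum : Set JForm :=
  {χ | ∃ (t s : JTerm) (φ : JForm),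
    χ = (box t φ).imp (box (t.sum s) φ) ∨ χ = (box t φ).imp (box (s.sum t) φ)}

/-- The scheme `t:φ → φ`. -/
def AxF : Set JForm := {χ | ∃ (t : JTerm) (φ : JForm), χ = (box t φ).imp φ}

/-- The scheme `t:φ → !t:t:φ`. -/
def AxI : Set JForm :=
  {χ | ∃ (t : JTerm) (φ : JForm), χ = (box t φ).imp (box t.bang (box t φ))}

/-- The total constant specification over a set `A` of axioms: all formulas
`c_{i_n} : … : c_{i_1} : φ` with `n ≥ 1` and `φ ∈ A`. -/
inductive TCS (A : Set JForm) : JForm → Prop where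
  | base (i : ℕ) {φ : JForm} : φ ∈ A → TCS A (box (JTerm.const i) φ)
  | step (i : ℕ) {φ : JForm} : TCS A φ → TCS A (box (JTerm.const i) φ)

/-- The theorems of the justification logic with axioms `A` and total constant specification:
`φ` is a theorem if `⋀ γ_i → φ` is derivable from `A` by modus ponens, for finitely many members
`γ_i` of the total constant specification. -/
def justLogic (A : Set JForm) : Set JForm :=
  {φ | ∃ l : List JForm, (∀ γ ∈ l, TCS A γ) ∧ MPClosure A ((bigAnd l).imp φ)}

/-- The logic `LJ` over the propositional logic `L`. -/
def justJ (L : Set PropForm) : Set JForm := justLogic (substClosure L ∪ AxJ ∪ AxSum)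

/-- The logic `LJT` over the propositional logic `L`. -/
def justJT (L : Set PropForm) : Set JForm := justLogic (substClosure L ∪ AxJ ∪ AxSum ∪ AxF)

/-- The logic `LJ4` over the propositional logic `L`. -/
def justJ4 (L : Set PropForm) : Set JForm := justLogic (substClosure L ∪ AxJ ∪ AxSum ∪ AxI)

/-- The logic `LJT4` over the propositional logic `L`. -/
def justJT4 (L : Set PropForm) : Set JForm :=
  justLogic (substClosure L ∪ AxJ ∪ AxSum ∪ AxF ∪ AxI)

/-! ### Modal logics based on a propositional logic -/

/-- The closure of a set of modal formulas under modus ponens, substitution and necessitation. -/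
inductive NormalClosure (Γ : Set ModalForm) : ModalForm → Prop where
  | base {φ : ModalForm} : φ ∈ Γ → NormalClosure Γ φ
  | mp {φ ψ : ModalForm} :
      NormalClosure Γ (φ.imp ψ) → NormalClosure Γ φ → NormalClosure Γ ψ
  | subst (σ : ℕ → ModalForm) {φ : ModalForm} :
      NormalClosure Γ φ → NormalClosure Γ (φ.subst σ)
  | nec {φ : ModalForm} : NormalClosure Γ φ → NormalClosure Γ (box () φ)

/-- `Γ ⊕ Δ`: the normal closure of `Γ ∪ Δ`. -/
def oplus (Γ Δ : Set ModalForm) : Set ModalForm := {φ | NormalClosure (Γ ∪ Δ) φ}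

/-- The scheme `□(φ → ψ) → (□φ → □ψ)`. -/
def AxK : Set ModalForm :=
  {χ | ∃ φ ψ : ModalForm, χ = (box () (φ.imp ψ)).imp ((box () φ).imp (box () ψ))}

/-- The scheme `□φ → φ`. -/
def AxT : Set ModalForm := {χ | ∃ φ : ModalForm, χ = (box () φ).imp φ}

/-- The scheme `□φ → □□φ`. -/
def Ax4 : Set ModalForm := {χ | ∃ φ : ModalForm, χ = (box () φ).imp (box () (box () φ))}

/-- The smallest intermediate modal logic. -/
def IPCK : Set ModalForm := oplus (ofProp Unit '' IPC) AxK

/-- The logic `LK` over the propositional logic `L`. -/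
def modalK (L : Set PropForm) : Set ModalForm := oplus IPCK (ofProp Unit '' L)

/-- The logic `LT` over the propositional logic `L`. -/
def modalT (L : Set PropForm) : Set ModalForm := oplus (modalK L) AxT

/-- The logic `LK4` over the propositional logic `L`. -/
def modalK4 (L : Set PropForm) : Set ModalForm := oplus (modalK L) Ax4

/-- The logic `LS4` over the propositional logic `L`. -/
def modalS4 (L : Set PropForm) : Set ModalForm := oplus (oplus (modalK L) AxT) Ax4

/-! ### Realizations -/

/-- `φ'` is a unique annotation of `φ`: dropping the indices of the boxes gives `φ`, and no index
occurs more than once. -/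
def IsUniqueAnnotation (φ : ModalForm) (φ' : AnnForm) : Prop :=
  φ'.map (fun _ => ()) = φ ∧ φ'.modalities.Nodup

/-- The two polarities. -/
inductive Pol : Type where
  | T : Pol
  | F : Pol

/-- The opposite polarity. -/
def Pol.flip : Pol → Pol
  | T => F
  | F => T

/-- The justification formulas that realize an annotated formula at a given polarity: at polarity
`T` the box `□_n` becomes the justification variable `x_n`, at polarity `F` any term. -/
def realizations : Pol → AnnForm → Set JForm
  | _, .bot => {.bot}
  | _, .var p => {.var p}
  | s, .and φ ψ => {χ | ∃ α ∈ realizations s φ, ∃ β ∈ realizations s ψ, χ = α.and β}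
  | s, .or φ ψ => {χ | ∃ α ∈ realizations s φ, ∃ β ∈ realizations s ψ, χ = α.or β}
  | s, .imp φ ψ =>
      {χ | ∃ α ∈ realizations s.flip φ, ∃ β ∈ realizations s ψ, χ = α.imp β}
  | Pol.T, .box n φ => {χ | ∃ α ∈ realizations Pol.T φ, χ = box (JTerm.var n) α}
  | Pol.F, .box _ φ => {χ | ∃ α ∈ realizations Pol.F φ, ∃ t : JTerm, χ = box t α}

/-- `ψ` is a realization of the modal formula `φ`. -/
def IsRealization (φ : ModalForm) (ψ : JForm) : Prop :=
  ∃ φ' : AnnForm, IsUniqueAnnotation φ φ' ∧ ψ ∈ realizations Pol.F φ'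

/-- The justification logic `J` realizes the modal logic `S`: every theorem of `S` has a
realization that is a theorem of `J`, and one can be found for any choice of a unique annotation. -/
def Realizes (J : Set JForm) (S : Set ModalForm) : Prop :=
  ∀ φ ∈ S, (∃ ψ ∈ J, IsRealization φ ψ) ∧
    ∀ φ' : AnnForm, IsUniqueAnnotation φ φ' → ∃ ψ ∈ J, ψ ∈ realizations Pol.F φ'

end InterJust

open InterJust

/-
A justification logic contains, for each scheme of the base logic `L`, all its instances, so its
prime theories form a frame that inherits the first-order property expressed by the scheme
(linearity, bounded height, directedness); with `(F)` and `(I)` accessibility is reflexive and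
transitive. Hence the theorems of the modal logic are valid in this canonical frame. By the truth
lemma a valid formula has a provable quasi-realization, in which several realizations of one
subformula may occur side by side, combined by `∨` at polarity `F` and by `∧` at polarity `T`.

Order the formulas by provable implication, reversed at polarity `T`. The combination of two
formulas is then their supremum, and all connectives are monotone, so that the combinations can
be pushed inwards through the propositional connectives. At a box of polarity `F` they are
absorbed by a sum of terms, and at `□_n` of polarity `T` by substituting `u · x_n` for `x_n`, with
`u` a sum of terms that prove the finitely many implications needed. The result is a realization.
-/

namespace InterJust

open Form

/-! ### Intuitionistic theories -/

/-- A set of formulas that contains all instances of the axiom schemes of intuitionistic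
propositional logic; this is `IntAxiom` for a language with arbitrary modalities. -/
structure IntSystem {M : Type} (B : Set (Form M)) : Prop where
  k : ∀ a b : Form M, a.imp (b.imp a) ∈ B
  s : ∀ a b c : Form M, (a.imp (b.imp c)).imp ((a.imp b).imp (a.imp c)) ∈ B
  andLeft : ∀ a b : Form M, (a.and b).imp a ∈ B
  andRight : ∀ a b : Form M, (a.and b).imp b ∈ B
  andIntro : ∀ a b : Form M, a.imp (b.imp (a.and b)) ∈ B
  orLeft : ∀ a b : Form M, a.imp (a.or b) ∈ B
  orRight : ∀ a b : Form M, b.imp (a.or b) ∈ B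
  orElim : ∀ a b c : Form M, (a.imp b).imp ((c.imp b).imp ((a.or c).imp b)) ∈ B
  exFalso : ∀ a : Form M, bot.imp a ∈ B

/-- A set of formulas that contains the intuitionistic axioms and is closed under modus ponens. -/
structure IntTheory {M : Type} (T : Set (Form M)) : Prop extends IntSystem T where
  mp : ∀ {a b : Form M}, a.imp b ∈ T → a ∈ T → b ∈ T

/-- An intuitionistic theory that is consistent and has the disjunction property. -/
structure PrimeTheory {M : Type} (T : Set (Form M)) : Prop extends IntTheory T where
  bot_notMem : bot ∉ T
  mem_or_mem : ∀ {a b : Form M}, a.or b ∈ T → a ∈ T ∨ b ∈ T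

section Theories

variable {M : Type} {B C T : Set (Form M)} {a b c d : Form M}

theorem subset_mpClosure (B : Set (Form M)) : B ⊆ {φ | MPClosure B φ} := fun _ => MPClosure.base

theorem IntSystem.mono (h : IntSystem B) (hBC : B ⊆ C) : IntSystem C :=
  ⟨fun _ _ => hBC (h.k _ _), fun _ _ _ => hBC (h.s _ _ _), fun _ _ => hBC (h.andLeft _ _),
    fun _ _ => hBC (h.andRight _ _), fun _ _ => hBC (h.andIntro _ _),
    fun _ _ => hBC (h.orLeft _ _), fun _ _ => hBC (h.orRight _ _),
    fun _ _ _ => hBC (h.orElim _ _ _), fun _ => hBC (h.exFalso _)⟩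

theorem IntSystem.intTheory_mpClosure (h : IntSystem B) : IntTheory {φ | MPClosure B φ} :=
  ⟨h.mono (subset_mpClosure B), MPClosure.mp⟩

namespace IntTheory

variable (hT : IntTheory T)
include hT

theorem imp_mem (ha : a ∈ T) (b : Form M) : b.imp a ∈ T := hT.mp (hT.k a b) ha

theorem imp_mp (hab : d.imp (a.imp b) ∈ T) (ha : d.imp a ∈ T) : d.imp b ∈ T :=
  hT.mp (hT.mp (hT.s _ _ _) hab) ha

theorem imp_refl (a : Form M) : a.imp a ∈ T := hT.imp_mp (hT.k a (a.imp a)) (hT.k a a)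

theorem imp_trans (hab : a.imp b ∈ T) (hbc : b.imp c ∈ T) : a.imp c ∈ T :=
  hT.imp_mp (hT.imp_mem hbc a) hab

theorem and_mem_iff : a.and b ∈ T ↔ a ∈ T ∧ b ∈ T :=
  ⟨fun hab => ⟨hT.mp (hT.andLeft _ _) hab, hT.mp (hT.andRight _ _) hab⟩,
    fun hab => hT.mp (hT.mp (hT.andIntro _ _) hab.1) hab.2⟩

theorem imp_and (hca : c.imp a ∈ T) (hcb : c.imp b ∈ T) : c.imp (a.and b) ∈ T :=
  hT.imp_mp (hT.imp_trans hca (hT.andIntro _ _)) hcb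

theorem or_imp (hac : a.imp c ∈ T) (hbc : b.imp c ∈ T) : (a.or b).imp c ∈ T :=
  hT.mp (hT.mp (hT.orElim _ _ _) hac) hbc

theorem and_mono (hab : a.imp b ∈ T) (hcd : c.imp d ∈ T) : (a.and c).imp (b.and d) ∈ T :=
  hT.imp_and (hT.imp_trans (hT.andLeft _ _) hab) (hT.imp_trans (hT.andRight _ _) hcd)

theorem or_mono (hab : a.imp b ∈ T) (hcd : c.imp d ∈ T) : (a.or c).imp (b.or d) ∈ T :=
  hT.or_imp (hT.imp_trans hab (hT.orLeft _ _)) (hT.imp_trans hcd (hT.orRight _ _))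

theorem imp_mono (hba : b.imp a ∈ T) (hcd : c.imp d ∈ T) : (a.imp c).imp (b.imp d) ∈ T :=
  have precompose : (a.imp c).imp (b.imp c) ∈ T :=
    hT.imp_mp (hT.imp_trans (hT.k (a.imp c) b) (hT.s _ _ _)) (hT.imp_mem hba _)
  hT.imp_trans precompose (hT.mp (hT.s _ _ _) (hT.imp_mem hcd b))

theorem bigAnd_imp_of_mem {l : List (Form M)} (ha : a ∈ l) : (bigAnd l).imp a ∈ T := by
  induction l with
  | nil => exact absurd ha List.not_mem_nil
  | cons b l ih =>
    cases l with
    | nil => exact List.mem_singleton.1 ha ▸ hT.imp_refl _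
    | cons c l =>
      rcases List.mem_cons.1 ha with rfl | ha
      · exact hT.andLeft _ _
      · exact hT.imp_trans (hT.andRight _ _) (ih ha)

theorem imp_bigAnd {l : List (Form M)} (hl : ∀ b ∈ l, a.imp b ∈ T) : a.imp (bigAnd l) ∈ T := by
  induction l with
  | nil => exact hT.imp_mem (hT.imp_refl _) _
  | cons b l ih =>
    obtain ⟨hb, hl⟩ := List.forall_mem_cons.1 hl
    cases l with
    | nil => exact hb
    | cons c l => exact hT.imp_and hb (ih hl)

theorem bigAnd_imp_bigAnd {l m : List (Form M)} (h : l ⊆ m) : (bigAnd m).imp (bigAnd l) ∈ T :=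
  hT.imp_bigAnd fun _ hb => hT.bigAnd_imp_of_mem (h hb)

theorem bigAnd_mem {l : List (Form M)} (hl : ∀ b ∈ l, b ∈ T) : bigAnd l ∈ T :=
  hT.mp (hT.imp_bigAnd fun b hb => hT.imp_mem (hl b hb) ((bot : Form M).imp bot)) (hT.imp_refl _)

/- The deduction theorem; directedness lets one assumption stand for the finitely many used. -/
theorem exists_imp_mem_of_mpClosure_union {X : Set (Form M)} (hne : X.Nonempty)
    (hX : DirectedOn (fun x y => y.imp x ∈ T) X) (ha : MPClosure (T ∪ X) a) :
    ∃ x ∈ X, x.imp a ∈ T := by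
  induction ha with
  | base ha =>
    rcases ha with ha | ha
    · exact ⟨_, hne.some_mem, hT.imp_mem ha _⟩
    · exact ⟨_, ha, hT.imp_refl _⟩
  | mp _ _ ih₁ ih₂ =>
    obtain ⟨x, hx, hxab⟩ := ih₁
    obtain ⟨y, hy, hya⟩ := ih₂
    obtain ⟨z, hz, hzx, hzy⟩ := hX x hx y hy
    exact ⟨z, hz, hT.imp_mp (hT.imp_trans hzx hxab) (hT.imp_trans hzy hya)⟩

theorem mpClosure_union (X : Set (Form M)) : IntTheory {φ | MPClosure (T ∪ X) φ} :=
  (hT.toIntSystem.mono Set.subset_union_left).intTheory_mpClosure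

theorem exists_maximal_disjoint {S : Set (Form M)} (hTS : Disjoint T S) :
    ∃ P, T ⊆ P ∧ Maximal (fun U => IntTheory U ∧ Disjoint U S) P := by
  refine zorn_subset_nonempty {U | IntTheory U ∧ Disjoint U S} ?_ T ⟨hT, hTS⟩
  rintro c hc hchain ⟨U₀, hU₀⟩
  have union_mp : ∀ {a b : Form M}, a.imp b ∈ ⋃₀ c → a ∈ ⋃₀ c → b ∈ ⋃₀ c := by
    rintro a b ⟨U, hU, hab⟩ ⟨V, hV, ha⟩
    rcases hchain.total hU hV with hUV | hVU
    · exact ⟨V, hV, (hc hV).1.mp (hUV hab) ha⟩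
    · exact ⟨U, hU, (hc hU).1.mp hab (hVU ha)⟩
  have union_axioms := (hc hU₀).1.toIntSystem.mono (Set.subset_sUnion_of_mem hU₀)
  exact ⟨⋃₀ c, ⟨⟨union_axioms, union_mp⟩, Set.disjoint_sUnion_left.2 fun U hU => (hc hU).2⟩,
    fun U hU => Set.subset_sUnion_of_mem hU⟩

omit hT in
theorem exists_imp_mem_of_maximal {P S : Set (Form M)}
    (hP : Maximal (fun U => IntTheory U ∧ Disjoint U S) P) (ha : a ∉ P) :
    ∃ x ∈ S, a.imp x ∈ P := by
  have hPT : IntTheory P := hP.prop.1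
  by_contra! hcon
  have hdisj : Disjoint {φ | MPClosure (P ∪ {a}) φ} S := Set.disjoint_left.2 fun x hx hxS => by
    obtain ⟨_, rfl, hax⟩ := hPT.exists_imp_mem_of_mpClosure_union (Set.singleton_nonempty a)
      (by rintro _ rfl _ rfl; exact ⟨_, rfl, hPT.imp_refl _, hPT.imp_refl _⟩) hx
    exact hcon x hxS hax
  have hsub := subset_mpClosure (P ∪ {a})
  exact ha (hP.le_of_ge ⟨hPT.mpClosure_union {a}, hdisj⟩
    (Set.subset_union_left.trans hsub) (hsub (Or.inr rfl)))

theorem exists_primeTheory_disjoint {S : Set (Form M)} (hne : S.Nonempty)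
    (hS : DirectedOn (fun x y => x.imp y ∈ T) S) (hTS : Disjoint T S) :
    ∃ P, PrimeTheory P ∧ T ⊆ P ∧ Disjoint P S := by
  obtain ⟨P, hTP, hP⟩ := hT.exists_maximal_disjoint hTS
  obtain ⟨hPT, hPS⟩ := hP.prop
  rw [Set.disjoint_left] at hPS
  refine ⟨P, ⟨hPT, fun hbot => ?_, fun {a b} hab => ?_⟩, hTP, hP.prop.2⟩
  · exact hPS (hPT.mp (hPT.exFalso _) hbot) hne.some_mem
  · by_contra! hcon
    obtain ⟨x, hx, hax⟩ := exists_imp_mem_of_maximal hP hcon.1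
    obtain ⟨y, hy, hby⟩ := exists_imp_mem_of_maximal hP hcon.2
    obtain ⟨z, hz, hxz, hyz⟩ := hS x hx y hy
    have hor : (a.or b).imp z ∈ P :=
      hPT.or_imp (hPT.imp_trans hax (hTP hxz)) (hPT.imp_trans hby (hTP hyz))
    exact hPS (hPT.mp hor hab) hz

end IntTheory

theorem PrimeTheory.or_mem_iff (hT : PrimeTheory T) : a.or b ∈ T ↔ a ∈ T ∨ b ∈ T :=
  ⟨hT.mem_or_mem, fun hab => hab.elim (hT.mp (hT.orLeft _ _)) (hT.mp (hT.orRight _ _))⟩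

theorem PrimeTheory.exists_mem_of_bigOr_mem (hT : PrimeTheory T) {l : List (Form M)}
    (hl : bigOr l ∈ T) : ∃ a ∈ l, a ∈ T := by
  induction l with
  | nil => exact absurd hl hT.bot_notMem
  | cons a l ih =>
    cases l with
    | nil => exact ⟨a, List.mem_cons_self, hl⟩
    | cons b l =>
      rcases hT.mem_or_mem hl with ha | hl
      · exact ⟨a, List.mem_cons_self, ha⟩
      · obtain ⟨x, hx, hxT⟩ := ih hl
        exact ⟨x, List.mem_cons_of_mem _ hx, hxT⟩

end Theories

/-! ### Substitution and change of modalities -/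

section Substitution

variable {M N K : Type}

theorem map_map (f : M → N) (g : N → K) (φ : Form M) : (φ.map f).map g = φ.map (g ∘ f) := by
  induction φ with simp_all only [Form.map, Function.comp_apply]

theorem map_subst (f : M → N) (σ : ℕ → Form M) (φ : Form M) :
    (φ.subst σ).map f = (φ.map f).subst fun p => (σ p).map f := by
  induction φ with simp_all only [Form.map, Form.subst]

theorem map_ofProp (f : M → N) (φ : PropForm) : (ofProp M φ).map f = ofProp N φ := by
  rw [ofProp, map_map, ofProp, Subsingleton.elim (f ∘ Empty.elim) Empty.elim]

theorem map_bigOr (f : M → N) (l : List (Form M)) :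
    (bigOr l).map f = bigOr (l.map (Form.map f)) := by
  induction l with
  | nil => rfl
  | cons a l ih => cases l with
    | nil => rfl
    | cons b l => simp only [bigOr, Form.map, ih, List.map_cons]

theorem map_bigAnd (f : M → N) (l : List (Form M)) :
    (bigAnd l).map f = bigAnd (l.map (Form.map f)) := by
  induction l with
  | nil => rfl
  | cons a l ih => cases l with
    | nil => rfl
    | cons b l => simp only [bigAnd, Form.map, ih, List.map_cons]

theorem subst_bigOr (σ : ℕ → Form M) (l : List (Form M)) :
    (bigOr l).subst σ = bigOr (l.map (Form.subst σ)) := by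
  induction l with
  | nil => rfl
  | cons a l ih => cases l with
    | nil => rfl
    | cons b l => simp only [bigOr, Form.subst, ih, List.map_cons]

theorem subst_bigAnd (σ : ℕ → Form M) (l : List (Form M)) :
    (bigAnd l).subst σ = bigAnd (l.map (Form.subst σ)) := by
  induction l with
  | nil => rfl
  | cons a l ih => cases l with
    | nil => rfl
    | cons b l => simp only [bigAnd, Form.subst, ih, List.map_cons]

end Substitution

/-! ### Kripke frames -/

/-- Intuitionistic forcing over the accessibility relation `R` and the valuation `V`. Boxes quantify
over accessible worlds only, so persistence needs `R` to be antitone in its first argument. -/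
def force {W : Type} [Preorder W] (R : W → W → Prop) (V : W → ℕ → Prop) : W → ModalForm → Prop
  | _, .bot => False
  | w, .var p => V w p
  | w, .and φ ψ => force R V w φ ∧ force R V w ψ
  | w, .or φ ψ => force R V w φ ∨ force R V w ψ
  | w, .imp φ ψ => ∀ v, w ≤ v → force R V v φ → force R V v ψ
  | w, .box _ φ => ∀ v, R w v → force R V v φ

/-- The modal formulas forced at all worlds under all persistent valuations. -/
def frameLogic {W : Type} [Preorder W] (R : W → W → Prop) : Set ModalForm :=
  {φ | ∀ V : W → ℕ → Prop, Monotone V → ∀ w, force R V w φ}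

/-- The propositional formulas forced at all worlds under all persistent valuations. -/
def propFrameLogic {W : Type} [Preorder W] (R : W → W → Prop) : Set PropForm :=
  ofProp Unit ⁻¹' frameLogic R

section Frames

variable {W : Type} [Preorder W] {R : W → W → Prop} {V : W → ℕ → Prop}

theorem force_mono (hR : Antitone R) (hV : Monotone V) (φ : ModalForm) {w v : W} (hwv : w ≤ v)
    (h : force R V w φ) : force R V v φ := by
  induction φ generalizing w v with
  | bot => exact h
  | var p => exact hV hwv p h
  | and φ ψ ih₁ ih₂ => exact ⟨ih₁ hwv h.1, ih₂ hwv h.2⟩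
  | or φ ψ ih₁ ih₂ => exact h.imp (ih₁ hwv) (ih₂ hwv)
  | imp φ ψ _ _ => exact fun u hvu => h u (hwv.trans hvu)
  | box m φ _ => exact fun u hvu => h u (hR hwv u hvu)

theorem force_subst (σ : ℕ → ModalForm) (φ : ModalForm) (w : W) :
    force R V w (φ.subst σ) ↔ force R (fun v p => force R V v (σ p)) w φ := by
  induction φ generalizing w with
  | bot => rfl
  | var p => rfl
  | and φ ψ ih₁ ih₂ => simp only [Form.subst, force, ih₁, ih₂]
  | or φ ψ ih₁ ih₂ => simp only [Form.subst, force, ih₁, ih₂]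
  | imp φ ψ ih₁ ih₂ => simp only [Form.subst, force, ih₁, ih₂]
  | box m φ ih => simp only [Form.subst, force, ih]

theorem force_bigAnd (l : List ModalForm) (w : W) :
    force R V w (bigAnd l) ↔ ∀ φ ∈ l, force R V w φ := by
  induction l with
  | nil => simp [bigAnd, neg, force]
  | cons φ l ih =>
    cases l with
    | nil => simp [bigAnd]
    | cons ψ l => simp only [bigAnd, force, ih, List.forall_mem_cons]

theorem force_bigOr (l : List ModalForm) (w : W) :
    force R V w (bigOr l) ↔ ∃ φ ∈ l, force R V w φ := by
  induction l with
  | nil => simp [bigOr, force]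
  | cons φ l ih =>
    cases l with
    | nil => simp [bigOr]
    | cons ψ l => simp only [bigOr, force, ih, List.exists_mem_cons_iff]

theorem frameLogic_mp {φ ψ : ModalForm} (h₁ : φ.imp ψ ∈ frameLogic R) (h₂ : φ ∈ frameLogic R) :
    ψ ∈ frameLogic R :=
  fun V hV w => h₁ V hV w w le_rfl (h₂ V hV w)

theorem plus_subset_propFrameLogic {Γ Δ : Set PropForm} (hΓ : Γ ⊆ propFrameLogic R)
    (hΔ : Δ ⊆ propFrameLogic R) : plus Γ Δ ⊆ propFrameLogic R := by
  intro φ h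
  induction h with
  | base h => exact h.elim (hΓ ·) (hΔ ·)
  | mp _ _ ih₁ ih₂ => exact frameLogic_mp ih₁ ih₂

theorem oplus_subset_frameLogic (hR : Antitone R) {Γ Δ : Set ModalForm}
    (hΓ : Γ ⊆ frameLogic R) (hΔ : Δ ⊆ frameLogic R) : oplus Γ Δ ⊆ frameLogic R := by
  intro φ h
  induction h with
  | base h => exact h.elim (hΓ ·) (hΔ ·)
  | mp _ _ ih₁ ih₂ => exact frameLogic_mp ih₁ ih₂
  | subst σ _ ih =>
    intro V hV w
    rw [force_subst]
    exact ih _ (fun _ _ hwv p => force_mono hR hV (σ p) hwv) w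
  | nec _ ih => exact fun V hV _ v _ => ih V hV v

theorem intAxiom_mem_propFrameLogic (hR : Antitone R) {φ : PropForm} (h : IntAxiom φ) :
    φ ∈ propFrameLogic R := by
  intro V hV w
  cases h with
  | a1 φ ψ => exact fun v _ hφ u hvu _ => force_mono hR hV _ hvu hφ
  | a2 φ χ ψ => exact fun v _ h u hvu h' x hux hx => h x (hvu.trans hux) hx x le_rfl (h' x hux hx)
  | a3 φ ψ => exact fun v _ h => h.1
  | a4 φ ψ => exact fun v _ h => h.2
  | a5 φ ψ => exact fun v _ hφ u hvu hψ => ⟨force_mono hR hV _ hvu hφ, hψ⟩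
  | a6 φ ψ => exact fun v _ h => Or.inl h
  | a7 φ ψ => exact fun v _ h => Or.inr h
  | a8 φ ψ χ => exact fun v _ h u hvu h' x hux hx => hx.elim (h x (hvu.trans hux)) (h' x hux)
  | a9 φ => exact fun v _ h => h.elim

theorem IPC_subset_propFrameLogic (hR : Antitone R) : IPC ⊆ propFrameLogic R := by
  intro φ h
  induction h with
  | base h => exact intAxiom_mem_propFrameLogic hR h
  | mp _ _ ih₁ ih₂ => exact frameLogic_mp ih₁ ih₂

theorem LIN_subset_propFrameLogic (hR : Antitone R)
    (hlin : ∀ w : W, IsChain (· ≤ ·) (Set.Ici w)) : LIN ⊆ propFrameLogic R := by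
  rintro _ ⟨φ, ψ, rfl⟩ V hV w
  change (∀ v, w ≤ v → _ → _) ∨ (∀ v, w ≤ v → _ → _)
  by_contra! hcon
  obtain ⟨⟨v, hwv, hv, hv'⟩, u, hwu, hu, hu'⟩ := hcon
  rcases (hlin w).total hwv hwu with hvu | huv
  · exact hu' (force_mono hR hV _ hvu hv)
  · exact hv' (force_mono hR hV _ huv hu)

theorem WLEM_subset_propFrameLogic (hR : Antitone R)
    (hdir : ∀ w : W, DirectedOn (· ≤ ·) (Set.Ici w)) : WLEM ⊆ propFrameLogic R := by
  rintro _ ⟨φ, rfl⟩ V hV w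
  change (∀ v, w ≤ v → (∀ u, v ≤ u → _ → False) → False) ∨ (∀ v, w ≤ v → _ → False)
  by_contra! hcon
  obtain ⟨⟨v, hwv, hv, -⟩, u, hwu, hu, -⟩ := hcon
  obtain ⟨x, -, hvx, hux⟩ := hdir w v hwv u hwu
  exact hv x hvx (force_mono hR hV _ hux hu)

theorem BC_subset_propFrameLogic (hR : Antitone R) {n : ℕ}
    (hlin : ∀ w : W, IsChain (· ≤ ·) (Set.Ici w))
    (hheight : ∀ c : Fin (n + 1) → W, ¬ StrictMono c) : BC n ⊆ propFrameLogic R := by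
  rintro _ ⟨f, rfl⟩ V hV w
  rw [ofProp, map_bigOr, force_bigOr]
  simp only [List.mem_map, List.mem_range, exists_exists_and_eq_and, Form.map, map_bigAnd,
    force, force_bigAnd, forall_exists_index, and_imp, forall_apply_eq_imp_iff₂]
  by_contra! hcon
  have : Nonempty W := ⟨w⟩
  choose! c hwc hlt hself using hcon
  refine hheight (fun i => c i) fun i j hij => ?_
  have hnot : ¬ c j ≤ c i := fun hle => hself i i.2 (force_mono hR hV _ hle (hlt j j.2 i hij))
  exact lt_of_le_not_ge (((hlin w).total (hwc i i.2) (hwc j j.2)).resolve_right hnot) hnot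

theorem modalK_subset_frameLogic (hR : Antitone R) {L : Set PropForm}
    (hL : L ⊆ propFrameLogic R) : modalK L ⊆ frameLogic R := by
  refine oplus_subset_frameLogic hR (oplus_subset_frameLogic hR ?_ ?_) ?_
  · exact Set.image_subset_iff.2 (IPC_subset_propFrameLogic hR)
  · rintro _ ⟨φ, ψ, rfl⟩ V _ w v _ h u hvu h' x hux
    exact h x (hR hvu x hux) x le_rfl (h' x hux)
  · exact Set.image_subset_iff.2 hL

theorem AxT_subset_frameLogic (hrefl : ∀ w, R w w) : AxT ⊆ frameLogic R := by
  rintro _ ⟨φ, rfl⟩ V _ w v _ h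
  exact h v (hrefl v)

theorem Ax4_subset_frameLogic (htrans : ∀ w v u, R w v → R v u → R w u) :
    Ax4 ⊆ frameLogic R := by
  rintro _ ⟨φ, rfl⟩ V _ w v _ h u hvu x hux
  exact h x (htrans _ _ _ hvu hux)

end Frames

/-! ### Justification terms and systems -/

/-- Substitution of terms for justification variables. -/
def JTerm.subst (τ : ℕ → JTerm) : JTerm → JTerm
  | var n => τ n
  | const i => const i
  | sum t s => (t.subst τ).sum (s.subst τ)
  | app t s => (t.subst τ).app (s.subst τ)
  | bang t => (t.subst τ).bang

/-- A term without justification variables. -/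
def JTerm.IsClosed (t : JTerm) : Prop := ∀ τ, t.subst τ = t

/-- The substitution that applies `σ` first and `τ` second. -/
def termComp (σ τ : ℕ → JTerm) : ℕ → JTerm := fun n => (σ n).subst τ

/-- Substitution of terms for justification variables in a formula. -/
abbrev Form.tsubst (τ : ℕ → JTerm) (φ : JForm) : JForm := φ.map (JTerm.subst τ)

/-- Closure under substitution of terms for justification variables. -/
def TSubstClosed (A : Set JForm) : Prop := ∀ τ, ∀ φ ∈ A, φ.tsubst τ ∈ A

section TermSubstitution

variable {A B : Set JForm}

theorem tsubst_tsubst (σ τ : ℕ → JTerm) (φ : JForm) :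
    (φ.tsubst σ).tsubst τ = φ.tsubst (termComp σ τ) := by
  have subst_subst : JTerm.subst τ ∘ JTerm.subst σ = JTerm.subst (termComp σ τ) := by
    funext t
    induction t with simp_all only [Function.comp_apply, JTerm.subst, termComp]
  rw [Form.tsubst, map_map, subst_subst]

theorem TSubstClosed.union (hA : TSubstClosed A) (hB : TSubstClosed B) : TSubstClosed (A ∪ B) :=
  fun τ φ => Or.imp (hA τ φ) (hB τ φ)

theorem TSubstClosed.substClosure (L : Set PropForm) : TSubstClosed (substClosure L) := by
  rintro τ _ ⟨φ, σ, hφ, rfl⟩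
  exact ⟨φ, _, hφ, by rw [Form.tsubst, map_subst, map_ofProp]⟩

theorem TSubstClosed.axJ : TSubstClosed AxJ := by
  rintro τ _ ⟨t, s, φ, ψ, rfl⟩
  exact ⟨_, _, _, _, rfl⟩

theorem TSubstClosed.axSum : TSubstClosed AxSum := by
  rintro τ _ ⟨t, s, φ, rfl | rfl⟩
  · exact ⟨_, _, _, Or.inl rfl⟩
  · exact ⟨_, _, _, Or.inr rfl⟩

theorem TSubstClosed.axF : TSubstClosed AxF := by
  rintro τ _ ⟨t, φ, rfl⟩
  exact ⟨_, _, rfl⟩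

theorem TSubstClosed.axI : TSubstClosed AxI := by
  rintro τ _ ⟨t, φ, rfl⟩
  exact ⟨_, _, rfl⟩

theorem TSubstClosed.tcs (hA : TSubstClosed A) : TSubstClosed {γ | TCS A γ} := by
  intro τ φ h
  induction h with
  | base i h => exact TCS.base i (hA τ _ h)
  | step i _ ih => exact TCS.step i ih

theorem TSubstClosed.mpClosure (hA : TSubstClosed A) : TSubstClosed {φ | MPClosure A φ} := by
  intro τ φ h
  induction h with
  | base h => exact .base (hA τ _ h)
  | mp _ _ ih₁ ih₂ => exact .mp ih₁ ih₂

end TermSubstitution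

/-- A set of axioms for a justification logic; the properties listed are those common to the
logics `LJ`, `LJT`, `LJ4` and `LJT4`. -/
structure JustSystem (A : Set JForm) : Prop extends IntSystem A where
  application : AxJ ⊆ A
  sum : AxSum ⊆ A
  tsubst : TSubstClosed A

/-- The closure of the axioms and their total constant specification under modus ponens. It
coincides with `justLogic`, whose definition moves the constant specification into a premise. -/
def justTheorems (A : Set JForm) : Set JForm := {φ | MPClosure (A ∪ {γ | TCS A γ}) φ}

theorem intSystem_substClosure {L : Set PropForm} (hL : IPC ⊆ L) :
    IntSystem (substClosure L) := by
  have instance_mem {χ : PropForm} (h : IntAxiom χ) (a b c : JForm) :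
      (ofProp JTerm χ).subst (fun | 0 => a | 1 => b | _ => c) ∈ substClosure L :=
    ⟨χ, _, hL (.base h), rfl⟩
  exact {
    k := fun a b => instance_mem (.a1 (var 0) (var 1)) a b a
    s := fun a b c => instance_mem (.a2 (var 0) (var 1) (var 2)) a b c
    andLeft := fun a b => instance_mem (.a3 (var 0) (var 1)) a b a
    andRight := fun a b => instance_mem (.a4 (var 0) (var 1)) a b a
    andIntro := fun a b => instance_mem (.a5 (var 0) (var 1)) a b a
    orLeft := fun a b => instance_mem (.a6 (var 0) (var 1)) a b a
    orRight := fun a b => instance_mem (.a7 (var 0) (var 1)) a b a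
    orElim := fun a b c => instance_mem (.a8 (var 0) (var 1) (var 2)) a b c
    exFalso := fun a => instance_mem (.a9 (var 0)) a a a }

theorem axioms_subset_justTheorems (A : Set JForm) : A ⊆ justTheorems A :=
  fun _ h => .base (Or.inl h)

namespace JustSystem

variable {A T : Set JForm}

theorem intTheory_justTheorems (hA : JustSystem A) : IntTheory (justTheorems A) :=
  (hA.toIntSystem.mono Set.subset_union_left).intTheory_mpClosure

theorem justTheorems_subset_justLogic (hA : JustSystem A) : justTheorems A ⊆ justLogic A := by
  have hT : IntTheory {φ | MPClosure A φ} := hA.toIntSystem.intTheory_mpClosure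
  intro φ h
  induction h with
  | base h =>
    rcases h with h | h
    · exact ⟨[], by simp, hT.imp_mem (.base h) _⟩
    · exact ⟨[_], by simpa using h, hT.imp_refl _⟩
  | mp _ _ ih₁ ih₂ =>
    obtain ⟨l, hl, hlab⟩ := ih₁
    obtain ⟨m, hm, hma⟩ := ih₂
    exact ⟨l ++ m, List.forall_mem_append.2 ⟨hl, hm⟩,
      hT.imp_mp (hT.imp_trans (hT.bigAnd_imp_bigAnd (List.subset_append_left l m)) hlab)
        (hT.imp_trans (hT.bigAnd_imp_bigAnd (List.subset_append_right l m)) hma)⟩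

theorem tsubst_mem (hA : JustSystem A) (τ : ℕ → JTerm) {φ : JForm} (h : φ ∈ justTheorems A) :
    φ.tsubst τ ∈ justTheorems A :=
  (hA.tsubst.union hA.tsubst.tcs).mpClosure τ φ h

theorem box_app_mem (hA : JustSystem A) (hT : IntTheory T) (hAT : A ⊆ T) {t : JTerm}
    {φ ψ : JForm} (h : box t (φ.imp ψ) ∈ T) (s : JTerm) :
    (box s φ).imp (box (t.app s) ψ) ∈ T :=
  hT.mp (hAT (hA.application ⟨_, _, _, _, rfl⟩)) h

theorem box_sum_left_mem (hA : JustSystem A) (t s : JTerm) (φ : JForm) :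
    (box t φ).imp (box (t.sum s) φ) ∈ A :=
  hA.sum ⟨_, _, _, Or.inl rfl⟩

theorem box_sum_right_mem (hA : JustSystem A) (t s : JTerm) (φ : JForm) :
    (box s φ).imp (box (t.sum s) φ) ∈ A :=
  hA.sum ⟨_, _, _, Or.inr rfl⟩

/- The constants of the total specification are closed and justify all axioms and all members of
the specification itself, so internalization never leaves the closed terms. -/
theorem exists_isClosed_box_mem (hA : JustSystem A) {φ : JForm} (h : φ ∈ justTheorems A) :
    ∃ t : JTerm, t.IsClosed ∧ box t φ ∈ justTheorems A := by
  induction h with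
  | base h => exact ⟨.const 0, fun _ => rfl, .base (Or.inr (h.elim (TCS.base 0) (TCS.step 0)))⟩
  | mp _ _ ih₁ ih₂ =>
    obtain ⟨t, ht, htab⟩ := ih₁
    obtain ⟨s, hs, hsa⟩ := ih₂
    exact ⟨t.app s, fun τ => congrArg₂ JTerm.app (ht τ) (hs τ),
      .mp (hA.box_app_mem hA.intTheory_justTheorems (axioms_subset_justTheorems A) htab s) hsa⟩

theorem exists_isClosed_forall_box_mem (hA : JustSystem A) {Y : Set JForm} (hY : Y.Finite)
    (h : Y ⊆ justTheorems A) : ∃ t : JTerm, t.IsClosed ∧ ∀ φ ∈ Y, box t φ ∈ justTheorems A := by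
  have hT := hA.intTheory_justTheorems
  have hAT := axioms_subset_justTheorems A
  induction Y, hY using Set.Finite.induction_on with
  | empty => exact ⟨.const 0, fun _ => rfl, by simp⟩
  | @insert φ Y _ _ ih =>
    obtain ⟨hφ, hY⟩ := Set.insert_subset_iff.1 h
    obtain ⟨t, ht, htφ⟩ := hA.exists_isClosed_box_mem hφ
    obtain ⟨s, hs, hsY⟩ := ih hY
    refine ⟨t.sum s, fun τ => congrArg₂ JTerm.sum (ht τ) (hs τ),
      Set.forall_mem_insert.2 ⟨?_, fun ψ hψ => ?_⟩⟩
    · exact hT.mp (hAT (hA.box_sum_left_mem t s φ)) htφ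
    · exact hT.mp (hAT (hA.box_sum_right_mem t s ψ)) (hsY ψ hψ)

end JustSystem

/-! ### Polarities and quasi-realizations -/

namespace Pol

/-- The combination of two realizations of the same subformula at a given polarity. -/
def comb {M : Type} : Pol → Form M → Form M → Form M
  | T => Form.and
  | F => Form.or

/-- Provable implication in `U`, reversed at polarity `T`. With this order `comb` is a supremum at
both polarities. -/
def Entails {M : Type} (U : Set (Form M)) : Pol → Form M → Form M → Prop
  | T, a, b => b.imp a ∈ U
  | F, a, b => a.imp b ∈ U

section Entails

variable {M : Type} {U V : Set (Form M)} {s : Pol} {a b c d : Form M}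

theorem Entails.mono (h : s.Entails U a b) (hUV : U ⊆ V) : s.Entails V a b := by
  cases s <;> exact hUV h

theorem entails_refl (hU : IntTheory U) (s : Pol) (a : Form M) : s.Entails U a a := by
  cases s <;> exact hU.imp_refl a

theorem Entails.trans (hU : IntTheory U) (hab : s.Entails U a b) (hbc : s.Entails U b c) :
    s.Entails U a c :=
  match s with
  | T => hU.imp_trans hbc hab
  | F => hU.imp_trans hab hbc

theorem entails_comb_left (hU : IntTheory U) (s : Pol) (a b : Form M) :
    s.Entails U a (s.comb a b) :=
  match s with
  | T => hU.andLeft a b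
  | F => hU.orLeft a b

theorem entails_comb_right (hU : IntTheory U) (s : Pol) (a b : Form M) :
    s.Entails U b (s.comb a b) :=
  match s with
  | T => hU.andRight a b
  | F => hU.orRight a b

theorem comb_entails (hU : IntTheory U) (hac : s.Entails U a c) (hbc : s.Entails U b c) :
    s.Entails U (s.comb a b) c :=
  match s with
  | T => hU.imp_and hac hbc
  | F => hU.or_imp hac hbc

theorem Entails.and (hU : IntTheory U) (hab : s.Entails U a b) (hcd : s.Entails U c d) :
    s.Entails U (a.and c) (b.and d) := by
  cases s <;> exact hU.and_mono hab hcd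

theorem Entails.or (hU : IntTheory U) (hab : s.Entails U a b) (hcd : s.Entails U c d) :
    s.Entails U (a.or c) (b.or d) := by
  cases s <;> exact hU.or_mono hab hcd

theorem Entails.imp (hU : IntTheory U) (hab : s.flip.Entails U a b) (hcd : s.Entails U c d) :
    s.Entails U (a.imp c) (b.imp d) := by
  cases s <;> exact hU.imp_mono hab hcd

end Entails

end Pol

/-- The combinations, at polarity `s`, of nonempty finite families of members of `X`. -/
inductive CombClosure {M : Type} (s : Pol) (X : Set (Form M)) : Form M → Prop where
  | base {a : Form M} : a ∈ X → CombClosure s X a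
  | comb {a b : Form M} : CombClosure s X a → CombClosure s X b → CombClosure s X (s.comb a b)

/-- The realizations of an annotated formula in which different realizations of one subformula may
be combined. -/
def quasiRealizations : Pol → AnnForm → Set JForm
  | s, .bot => {χ | CombClosure s {.bot} χ}
  | s, .var p => {χ | CombClosure s {.var p} χ}
  | s, .and φ ψ =>
      {χ | CombClosure s (Set.image2 .and (quasiRealizations s φ) (quasiRealizations s ψ)) χ}
  | s, .or φ ψ =>
      {χ | CombClosure s (Set.image2 .or (quasiRealizations s φ) (quasiRealizations s ψ)) χ}
  | s, .imp φ ψ =>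
      {χ | CombClosure s (Set.image2 .imp (quasiRealizations s.flip φ) (quasiRealizations s ψ)) χ}
  | .T, .box n φ => {χ | CombClosure .T (box (.var n) '' quasiRealizations .T φ) χ}
  | .F, .box _ φ => {χ | CombClosure .F (Set.image2 box Set.univ (quasiRealizations .F φ)) χ}

section QuasiRealizations

variable {M : Type} {U X : Set (Form M)} {s : Pol}

theorem subset_combClosure (s : Pol) (X : Set (Form M)) : X ⊆ {a | CombClosure s X a} :=
  fun _ => .base

theorem CombClosure.directedOn (hU : IntTheory U) (s : Pol) (X : Set (Form M)) :
    DirectedOn (s.Entails U) {a | CombClosure s X a} :=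
  fun a ha b hb =>
    ⟨s.comb a b, ha.comb hb, s.entails_comb_left hU a b, s.entails_comb_right hU a b⟩

theorem CombClosure.entails (hU : IntTheory U) {a b : Form M} (h : CombClosure s X a)
    (hX : ∀ x ∈ X, s.Entails U x b) : s.Entails U a b := by
  induction h with
  | base h => exact hX _ h
  | comb _ _ ih₁ ih₂ => exact s.comb_entails hU ih₁ ih₂

theorem quasiRealizations_directedOn {U : Set JForm} (hU : IntTheory U) (s : Pol) (φ : AnnForm) :
    DirectedOn (s.Entails U) (quasiRealizations s φ) := by
  cases φ <;> cases s <;> exact CombClosure.directedOn hU _ _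

theorem quasiRealizations_nonempty (s : Pol) (φ : AnnForm) : (quasiRealizations s φ).Nonempty := by
  induction φ generalizing s with
  | bot => exact ⟨.bot, .base rfl⟩
  | var p => exact ⟨.var p, .base rfl⟩
  | and φ ψ ih₁ ih₂ => exact ((ih₁ s).image2 (ih₂ s)).mono (subset_combClosure _ _)
  | or φ ψ ih₁ ih₂ => exact ((ih₁ s).image2 (ih₂ s)).mono (subset_combClosure _ _)
  | imp φ ψ ih₁ ih₂ => exact ((ih₁ s.flip).image2 (ih₂ s)).mono (subset_combClosure _ _)
  | box n φ ih =>
    cases s with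
    | T => exact ((ih .T).image _).mono (subset_combClosure _ _)
    | F =>
      obtain ⟨α, hα⟩ := ih .F
      exact ⟨box (.const 0) α, .base ⟨_, Set.mem_univ _, α, hα, rfl⟩⟩

end QuasiRealizations

/-! ### The canonical model -/

/-- Worlds of the canonical model: prime theories that contain all theorems of the justification
logic, ordered by inclusion. -/
def World (A : Set JForm) : Type := {Γ : Set JForm // PrimeTheory Γ ∧ justTheorems A ⊆ Γ}

instance (A : Set JForm) : PartialOrder (World A) := inferInstanceAs (PartialOrder (Subtype _))

/-- The formulas justified in `Γ` by some term. -/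
def justified (Γ : Set JForm) : Set JForm := {α | ∃ t, box t α ∈ Γ}

/-- Canonical accessibility. -/
def World.Rel {A : Set JForm} (w v : World A) : Prop := justified w.1 ⊆ v.1

/-- Canonical valuation. -/
def World.val {A : Set JForm} (w : World A) (p : ℕ) : Prop := Form.var p ∈ w.1

/-- The modal formula obtained by dropping the indices of the boxes. -/
abbrev Form.erase (φ : AnnForm) : ModalForm := φ.map fun _ => ()

/-- The statement of the truth lemma for `φ`: membership of quasi-realizations and forcing are
compared by two implications, one for each polarity. -/
structure TruthCondition (A : Set JForm) (φ : AnnForm) : Prop where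
  force_of_subset : ∀ w : World A, quasiRealizations .T φ ⊆ w.1 →
    force World.Rel World.val w φ.erase
  exists_mem_of_force : ∀ w : World A, force World.Rel World.val w φ.erase →
    ∃ α ∈ quasiRealizations .F φ, α ∈ w.1

section Canonical

variable {A : Set JForm} {φ ψ : AnnForm}

theorem World.antitone_rel : Antitone (World.Rel (A := A)) :=
  fun _ _ hwv _ hvu _ ⟨t, ht⟩ => hvu ⟨t, hwv ht⟩

theorem World.monotone_val : Monotone (World.val (A := A)) :=
  fun _ _ hwv _ hp => hwv hp

theorem exists_world_disjoint {T S : Set JForm} (hT : IntTheory T) (hAT : justTheorems A ⊆ T)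
    (hne : S.Nonempty) (hS : DirectedOn (Pol.F.Entails T) S) (hTS : Disjoint T S) :
    ∃ v : World A, T ⊆ v.1 ∧ Disjoint v.1 S := by
  obtain ⟨P, hP, hTP, hPS⟩ := hT.exists_primeTheory_disjoint hne hS hTS
  exact ⟨⟨P, hP, hAT.trans hTP⟩, hTP, hPS⟩

namespace World

variable (w : World A)

theorem theory : IntTheory w.1 := w.2.1.toIntTheory

theorem axioms_subset : A ⊆ w.1 := (axioms_subset_justTheorems A).trans w.2.2

theorem exists_ge {X S : Set JForm} (hXne : X.Nonempty) (hX : DirectedOn (Pol.T.Entails w.1) X)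
    (hSne : S.Nonempty) (hS : DirectedOn (Pol.F.Entails w.1) S)
    (hXS : ∀ α ∈ X, ∀ β ∈ S, α.imp β ∉ w.1) : ∃ v ≥ w, X ⊆ v.1 ∧ Disjoint v.1 S := by
  have hsub := subset_mpClosure (w.1 ∪ X)
  have hw := Set.subset_union_left.trans hsub
  have hdisj : Disjoint {φ | MPClosure (w.1 ∪ X) φ} S := Set.disjoint_left.2 fun β hβ hβS => by
    obtain ⟨α, hα, hαβ⟩ := w.theory.exists_imp_mem_of_mpClosure_union hXne hX hβ
    exact hXS α hα β hβS hαβ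
  obtain ⟨v, hv, hvS⟩ := exists_world_disjoint (w.theory.mpClosure_union X) (w.2.2.trans hw) hSne
    (hS.mono fun _ _ h => h.mono hw) hdisj
  exact ⟨v, hw.trans hv, Set.subset_union_right.trans (hsub.trans hv), hvS⟩

theorem intTheory_justified (hA : JustSystem A) : IntTheory (justified w.1) := by
  refine ⟨hA.toIntSystem.mono fun α h => ⟨.const 0, w.2.2 (.base (Or.inr (TCS.base 0 h)))⟩, ?_⟩
  rintro a b ⟨t, ht⟩ ⟨s, hs⟩
  exact ⟨t.app s, w.theory.mp (hA.box_app_mem w.theory w.axioms_subset ht s) hs⟩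

theorem justTheorems_subset_justified (hA : JustSystem A) : justTheorems A ⊆ justified w.1 :=
  fun _ h =>
    have ⟨t, _, ht⟩ := hA.exists_isClosed_box_mem h
    ⟨t, w.2.2 ht⟩

end World

namespace TruthCondition

theorem bot : TruthCondition A .bot where
  force_of_subset w h := w.2.1.bot_notMem (h (.base rfl))
  exists_mem_of_force _ h := h.elim

theorem var (p : ℕ) : TruthCondition A (.var p) where
  force_of_subset _ h := h (.base rfl)
  exists_mem_of_force _ h := ⟨_, .base rfl, h⟩

theorem and (hφ : TruthCondition A φ) (hψ : TruthCondition A ψ) :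
    TruthCondition A (φ.and ψ) where
  force_of_subset w h := by
    have hmem {α β : JForm} (hα : α ∈ quasiRealizations .T φ) (hβ : β ∈ quasiRealizations .T ψ) :
        α ∈ w.1 ∧ β ∈ w.1 :=
      w.theory.and_mem_iff.1 (h (.base ⟨α, hα, β, hβ, rfl⟩))
    exact ⟨hφ.force_of_subset w fun α hα => (hmem hα (quasiRealizations_nonempty .T ψ).some_mem).1,
      hψ.force_of_subset w fun β hβ => (hmem (quasiRealizations_nonempty .T φ).some_mem hβ).2⟩
  exists_mem_of_force w h := by
    obtain ⟨α, hα, hαw⟩ := hφ.exists_mem_of_force w h.1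
    obtain ⟨β, hβ, hβw⟩ := hψ.exists_mem_of_force w h.2
    exact ⟨_, .base ⟨α, hα, β, hβ, rfl⟩, w.theory.and_mem_iff.2 ⟨hαw, hβw⟩⟩

theorem or (hφ : TruthCondition A φ) (hψ : TruthCondition A ψ) :
    TruthCondition A (φ.or ψ) where
  force_of_subset w h := by
    by_cases hsub : quasiRealizations .T φ ⊆ w.1
    · exact Or.inl (hφ.force_of_subset w hsub)
    · obtain ⟨α, hα, hαw⟩ := Set.not_subset.1 hsub
      exact Or.inr (hψ.force_of_subset w fun β hβ =>
        (w.2.1.mem_or_mem (h (.base ⟨α, hα, β, hβ, rfl⟩))).resolve_left hαw)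
  exists_mem_of_force w h := by
    rcases h with h | h
    · obtain ⟨α, hα, hαw⟩ := hφ.exists_mem_of_force w h
      obtain ⟨β, hβ⟩ := quasiRealizations_nonempty .F ψ
      exact ⟨_, .base ⟨α, hα, β, hβ, rfl⟩, w.2.1.or_mem_iff.2 (Or.inl hαw)⟩
    · obtain ⟨α, hα⟩ := quasiRealizations_nonempty .F φ
      obtain ⟨β, hβ, hβw⟩ := hψ.exists_mem_of_force w h
      exact ⟨_, .base ⟨α, hα, β, hβ, rfl⟩, w.2.1.or_mem_iff.2 (Or.inr hβw)⟩

theorem imp (hφ : TruthCondition A φ) (hψ : TruthCondition A ψ) :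
    TruthCondition A (φ.imp ψ) where
  force_of_subset w h v hwv hv := by
    obtain ⟨α, hα, hαv⟩ := hφ.exists_mem_of_force v hv
    exact hψ.force_of_subset v fun β hβ =>
      v.theory.mp (hwv (h (.base ⟨α, hα, β, hβ, rfl⟩))) hαv
  exists_mem_of_force w h := by
    by_contra! hcon
    obtain ⟨v, hwv, hv, hdisj⟩ := w.exists_ge
      (quasiRealizations_nonempty .T φ) (quasiRealizations_directedOn w.theory .T φ)
      (quasiRealizations_nonempty .F ψ) (quasiRealizations_directedOn w.theory .F ψ)
      fun α hα β hβ => hcon _ (.base ⟨α, hα, β, hβ, rfl⟩)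
    obtain ⟨β, hβ, hβv⟩ := hψ.exists_mem_of_force v (h v hwv (hφ.force_of_subset v hv))
    exact Set.disjoint_left.1 hdisj hβv hβ

theorem box (hA : JustSystem A) (n : ℕ) (hφ : TruthCondition A φ) :
    TruthCondition A (.box n φ) where
  force_of_subset _ h v hwv :=
    hφ.force_of_subset v fun α hα => hwv ⟨_, h (.base ⟨α, hα, rfl⟩)⟩
  exists_mem_of_force w h := by
    by_contra! hcon
    have hw := w.intTheory_justified hA
    have hdisj : Disjoint (justified w.1) (quasiRealizations .F φ) :=
      Set.disjoint_left.2 fun α ⟨t, ht⟩ hα => hcon _ (.base ⟨t, trivial, α, hα, rfl⟩) ht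
    obtain ⟨v, hwv, hv⟩ := exists_world_disjoint hw (w.justTheorems_subset_justified hA)
      (quasiRealizations_nonempty .F φ) (quasiRealizations_directedOn hw .F φ) hdisj
    obtain ⟨α, hα, hαv⟩ := hφ.exists_mem_of_force v (h v hwv)
    exact Set.disjoint_left.1 hv hαv hα

end TruthCondition

theorem JustSystem.truthCondition (hA : JustSystem A) (φ : AnnForm) : TruthCondition A φ := by
  induction φ with
  | bot => exact .bot
  | var p => exact .var p
  | and _ _ ih₁ ih₂ => exact ih₁.and ih₂
  | or _ _ ih₁ ih₂ => exact ih₁.or ih₂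
  | imp _ _ ih₁ ih₂ => exact ih₁.imp ih₂
  | box n _ ih => exact ih.box hA n

theorem JustSystem.exists_quasiRealization_mem (hA : JustSystem A)
    (hφ : φ.erase ∈ frameLogic (World.Rel (A := A))) :
    ∃ α ∈ quasiRealizations .F φ, α ∈ justTheorems A := by
  by_contra! hcon
  have hT := hA.intTheory_justTheorems
  obtain ⟨w, -, hw⟩ := exists_world_disjoint hT subset_rfl (quasiRealizations_nonempty .F φ)
    (quasiRealizations_directedOn hT .F φ) (Set.disjoint_right.2 hcon)
  obtain ⟨α, hα, hαw⟩ :=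
    (hA.truthCondition φ).exists_mem_of_force w (hφ World.val World.monotone_val w)
  exact Set.disjoint_left.1 hw hαw hα

end Canonical

/-! ### Properties of the canonical frame -/

namespace World

variable {A : Set JForm}

theorem rel_refl (hF : AxF ⊆ A) (w : World A) : w.Rel w :=
  fun α ⟨t, ht⟩ => w.theory.mp (w.axioms_subset (hF ⟨t, α, rfl⟩)) ht

theorem rel_trans (hI : AxI ⊆ A) (w v u : World A) (hwv : w.Rel v) (hvu : v.Rel u) : w.Rel u :=
  fun α ⟨t, ht⟩ =>
    hvu ⟨t, hwv ⟨t.bang, w.theory.mp (w.axioms_subset (hI ⟨t, α, rfl⟩)) ht⟩⟩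

theorem isChain_Ici (hL : substClosure LIN ⊆ A) (w : World A) : IsChain (· ≤ ·) (Set.Ici w) := by
  rintro v hwv u hwu -
  by_contra! hcon
  obtain ⟨α, hαv, hαu⟩ := Set.not_subset.1 hcon.1
  obtain ⟨β, hβu, hβv⟩ := Set.not_subset.1 hcon.2
  have h : (α.imp β).or (β.imp α) ∈ w.1 := w.axioms_subset
    (hL ⟨_, fun | 0 => α | _ => β, ⟨.var 0, .var 1, rfl⟩, rfl⟩)
  rcases w.2.1.mem_or_mem h with h | h
  · exact hβv (v.theory.mp (hwv h) hαv)
  · exact hαu (u.theory.mp (hwu h) hβu)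

theorem directedOn_Ici (hL : substClosure WLEM ⊆ A) (w : World A) :
    DirectedOn (· ≤ ·) (Set.Ici w) := by
  rintro v hwv u hwu
  have hu : DirectedOn (Pol.T.Entails v.1) u.1 := fun α hα β hβ =>
    ⟨α.and β, u.theory.and_mem_iff.2 ⟨hα, hβ⟩, v.theory.andLeft α β, v.theory.andRight α β⟩
  have hbot : DirectedOn (Pol.F.Entails v.1) {.bot} := by
    rintro _ rfl _ rfl
    exact ⟨_, rfl, v.theory.imp_refl _, v.theory.imp_refl _⟩
  have consistent : ∀ α ∈ u.1, ∀ β ∈ ({.bot} : Set JForm), α.imp β ∉ v.1 := by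
    rintro α hα _ rfl hαv
    have h : α.neg.neg.or α.neg ∈ w.1 := w.axioms_subset
      (hL ⟨_, fun _ => α, ⟨.var 0, rfl⟩, rfl⟩)
    rcases w.2.1.mem_or_mem h with h | h
    · exact v.2.1.bot_notMem (v.theory.mp (hwv h) hαv)
    · exact u.2.1.bot_notMem (u.theory.mp (hwu h) hα)
  obtain ⟨x, hvx, hux, -⟩ :=
    v.exists_ge ⟨_, u.theory.imp_refl .bot⟩ hu (Set.singleton_nonempty _) hbot consistent
  exact ⟨x, hwv.trans hvx, hvx, hux⟩

theorem exists_notMem_forall_lt_mem {n : ℕ} {c : Fin (n + 1) → World A} (hc : StrictMono c)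
    (i : Fin (n + 1)) : ∃ α ∉ (c i).1, ∀ j, i < j → α ∈ (c j).1 := by
  cases i using Fin.lastCases with
  | last => exact ⟨.bot, (c _).2.1.bot_notMem, fun j hj => absurd hj (Fin.le_last j).not_gt⟩
  | cast i =>
    obtain ⟨α, hα, hαi⟩ := Set.not_subset.1 (hc i.castSucc_lt_succ).not_ge
    exact ⟨α, hαi, fun j hj => hc.monotone (Fin.castSucc_lt_iff_succ_le.1 hj) hα⟩

theorem not_strictMono {n : ℕ} (hL : substClosure (BC n) ⊆ A) (c : Fin (n + 1) → World A) :
    ¬ StrictMono c := by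
  intro hc
  choose α hα hαlt using exists_notMem_forall_lt_mem hc
  let f (i : ℕ) : JForm := α (Fin.ofNat (n + 1) i)
  have h : bigOr ((List.range (n + 1)).map fun i =>
      (bigAnd ((List.range i).map f)).imp (f i)) ∈ (c 0).1 := by
    refine (c 0).axioms_subset (hL ⟨_, f, ⟨.var, rfl⟩, ?_⟩)
    simp only [ofProp, map_bigOr, subst_bigOr, map_bigAnd, subst_bigAnd, List.map_map,
      Function.comp_def, Form.map, Form.subst]
  obtain ⟨_, hmem, hc₀⟩ := (c 0).2.1.exists_mem_of_bigOr_mem h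
  obtain ⟨i, hi, rfl⟩ := List.mem_map.1 hmem
  have hle : c 0 ≤ c (Fin.ofNat (n + 1) i) := hc.monotone (Fin.zero_le _)
  refine hα _ ((c _).theory.mp (hle hc₀) ((c _).theory.bigAnd_mem fun b hb => ?_))
  obtain ⟨j, hj, rfl⟩ := List.mem_map.1 hb
  rw [List.mem_range] at hi hj
  refine hαlt _ _ (Fin.lt_def.2 ?_)
  rwa [Fin.val_ofNat, Fin.val_ofNat, Nat.mod_eq_of_lt (hj.trans hi), Nat.mod_eq_of_lt hi]

end World

/-! ### From quasi-realizations to realizations -/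

/-- A substitution that is the identity outside `l` and whose value at `n` involves no variable
but `x_n`. Such substitutions commute if the lists are disjoint. -/
structure LivesOn (σ : ℕ → JTerm) (l : List ℕ) : Prop where
  eq_var : ∀ n ∉ l, σ n = .var n
  no_new : ∀ (n : ℕ) (τ : ℕ → JTerm), τ n = .var n → (σ n).subst τ = σ n

section LivesOn

variable {σ τ : ℕ → JTerm} {l m : List ℕ}

theorem LivesOn.nil : LivesOn JTerm.var [] := ⟨fun _ _ => rfl, fun _ _ h => h⟩

theorem LivesOn.mono (hσ : LivesOn σ l) (hlm : l ⊆ m) : LivesOn σ m :=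
  ⟨fun n hn => hσ.eq_var n fun h => hn (hlm h), hσ.no_new⟩

theorem LivesOn.update {n : ℕ} {t : JTerm} (ht : ∀ τ : ℕ → JTerm, τ n = .var n → t.subst τ = t) :
    LivesOn (Function.update JTerm.var n t) [n] where
  eq_var m hm := Function.update_of_ne (List.ne_of_not_mem_cons hm) _ _
  no_new m τ hτ := by
    obtain rfl | hmn := eq_or_ne m n
    · rw [Function.update_self]
      exact ht τ hτ
    · rw [Function.update_of_ne hmn]
      exact hτ

theorem LivesOn.comp (hσ : LivesOn σ l) (hτ : LivesOn τ m) (hlm : l.Disjoint m) :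
    LivesOn (termComp σ τ) (l ++ m) where
  eq_var n hn := by
    rw [List.mem_append, not_or] at hn
    rw [termComp, hσ.eq_var n hn.1]
    exact hτ.eq_var n hn.2
  no_new n ρ hρ := by
    by_cases hn : n ∈ l
    · rw [termComp, hσ.no_new n τ (hτ.eq_var n (hlm hn)), hσ.no_new n ρ hρ]
    · rw [termComp, hσ.eq_var n hn]
      exact hτ.no_new n ρ hρ

theorem LivesOn.termComp_comm (hσ : LivesOn σ l) (hτ : LivesOn τ m) (hlm : l.Disjoint m) :
    termComp τ σ = termComp σ τ := by
  funext n
  by_cases hn : n ∈ l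
  · have hτn := hτ.eq_var n (hlm hn)
    rw [termComp, termComp, hσ.no_new n τ hτn, hτn, JTerm.subst]
  · have hσn := hσ.eq_var n hn
    rw [termComp, termComp, hτ.no_new n σ hσn, hσn, JTerm.subst]

theorem tsubst_mem_realizations {φ : AnnForm} (hτ : ∀ n ∈ φ.modalities, τ n = .var n) {s : Pol}
    {α : JForm} (h : α ∈ realizations s φ) : α.tsubst τ ∈ realizations s φ := by
  induction φ generalizing s α with
  | bot => cases h; rfl
  | var p => cases h; rfl
  | and φ ψ ih₁ ih₂ | or φ ψ ih₁ ih₂ | imp φ ψ ih₁ ih₂ =>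
    obtain ⟨hφ, hψ⟩ := List.forall_mem_append.1 hτ
    obtain ⟨β, hβ, γ, hγ, rfl⟩ := h
    exact ⟨_, ih₁ hφ hβ, _, ih₂ hψ hγ, rfl⟩
  | box n φ ih =>
    obtain ⟨hn, hφ⟩ := List.forall_mem_cons.1 hτ
    cases s with
    | T =>
      obtain ⟨β, hβ, rfl⟩ := h
      exact ⟨_, ih hφ hβ, by rw [Form.tsubst, Form.map, JTerm.subst, hn]⟩
    | F =>
      obtain ⟨β, hβ, t, rfl⟩ := h
      exact ⟨_, ih hφ hβ, _, rfl⟩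

end LivesOn

/-- Some realization of `φ` bounds `χ`, after a substitution for the variables that `φ`
provides. -/
def Convertible (A : Set JForm) (s : Pol) (φ : AnnForm) (χ : JForm) : Prop :=
  ∃ σ, LivesOn σ φ.modalities ∧
    ∃ γ ∈ realizations s φ, s.Entails (justTheorems A) (χ.tsubst σ) γ

section Directed

variable {M : Type} {U X Y : Set (Form M)} {s s₁ s₂ : Pol}

theorem CombClosure.exists_entails (hU : IntTheory U) (hX : DirectedOn (s.Entails U) X)
    {a : Form M} (h : CombClosure s X a) : ∃ x ∈ X, s.Entails U a x := by
  induction h with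
  | base h => exact ⟨_, h, s.entails_refl hU _⟩
  | comb _ _ ih₁ ih₂ =>
    obtain ⟨x, hx, hax⟩ := ih₁
    obtain ⟨y, hy, hby⟩ := ih₂
    obtain ⟨z, hz, hxz, hyz⟩ := hX x hx y hy
    exact ⟨z, hz, s.comb_entails hU (hax.trans hU hxz) (hby.trans hU hyz)⟩

theorem directedOn_entails_singleton (hU : IntTheory U) (s : Pol) (a : Form M) :
    DirectedOn (s.Entails U) {a} := by
  rintro _ rfl _ rfl
  exact ⟨_, rfl, s.entails_refl hU _, s.entails_refl hU _⟩

theorem directedOn_entails_image2 {op : Form M → Form M → Form M}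
    (hop : ∀ {a b c d}, s₁.Entails U a b → s₂.Entails U c d → s.Entails U (op a c) (op b d))
    (hX : DirectedOn (s₁.Entails U) X) (hY : DirectedOn (s₂.Entails U) Y) :
    DirectedOn (s.Entails U) (Set.image2 op X Y) := by
  rintro _ ⟨a, ha, b, hb, rfl⟩ _ ⟨c, hc, d, hd, rfl⟩
  obtain ⟨x, hx, hax, hcx⟩ := hX a ha c hc
  obtain ⟨y, hy, hby, hdy⟩ := hY b hb d hd
  exact ⟨op x y, ⟨x, hx, y, hy, rfl⟩, hop hax hby, hop hcx hdy⟩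

theorem exists_forall_entails (hU : IntTheory U) (hX : DirectedOn (s.Entails U) X)
    (hne : X.Nonempty) (hY : Y.Finite) (hYX : Y ⊆ X) : ∃ x ∈ X, ∀ y ∈ Y, s.Entails U y x := by
  induction Y, hY using Set.Finite.induction_on with
  | empty => exact ⟨_, hne.some_mem, fun _ h => h.elim⟩
  | insert _ _ ih =>
    obtain ⟨hy, hYX⟩ := Set.insert_subset_iff.1 hYX
    obtain ⟨x, hx, hYx⟩ := ih hYX
    obtain ⟨z, hz, hxz, hyz⟩ := hX x hx _ hy
    exact ⟨z, hz, Set.forall_mem_insert.2 ⟨hyz, fun y hy => (hYx y hy).trans hU hxz⟩⟩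

theorem CombClosure.exists_finite_image {f : Form M → Form M} {a : Form M}
    (h : CombClosure s (f '' X) a) : ∃ Y ⊆ X, Y.Finite ∧ CombClosure s (f '' Y) a := by
  have mono {Y Z : Set (Form M)} (hYZ : Y ⊆ Z) {a : Form M} (h : CombClosure s (f '' Y) a) :
      CombClosure s (f '' Z) a := by
    induction h with
    | base h => exact .base (Set.image_mono hYZ h)
    | comb _ _ ih₁ ih₂ => exact .comb ih₁ ih₂
  induction h with
  | base h =>
    obtain ⟨x, hx, rfl⟩ := h
    exact ⟨{x}, Set.singleton_subset_iff.2 hx, Set.finite_singleton x, .base ⟨x, rfl, rfl⟩⟩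
  | comb _ _ ih₁ ih₂ =>
    obtain ⟨Y, hYX, hY, ha⟩ := ih₁
    obtain ⟨Z, hZX, hZ, hb⟩ := ih₂
    exact ⟨Y ∪ Z, Set.union_subset hYX hZX, hY.union hZ,
      .comb (mono Set.subset_union_left ha) (mono Set.subset_union_right hb)⟩

theorem CombClosure.tsubst {X : Set JForm} {α : JForm} (σ : ℕ → JTerm) (h : CombClosure s X α) :
    CombClosure s (Form.tsubst σ '' X) (α.tsubst σ) := by
  induction h with
  | base h => exact .base ⟨_, h, rfl⟩
  | comb _ _ ih₁ ih₂ => cases s <;> exact .comb ih₁ ih₂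

end Directed

section Conversion

variable {A : Set JForm} {s s₁ s₂ : Pol} {φ ψ : AnnForm} {α β χ χ' : JForm}

namespace JustSystem

variable (hA : JustSystem A)
include hA

theorem entails_tsubst (τ : ℕ → JTerm) (h : s.Entails (justTheorems A) α β) :
    s.Entails (justTheorems A) (α.tsubst τ) (β.tsubst τ) := by
  cases s <;> exact hA.tsubst_mem τ h

theorem exists_box_imp_box_mem (h : α.imp β ∈ justTheorems A) (s : JTerm) :
    ∃ t, (box s α).imp (box t β) ∈ justTheorems A :=
  have ⟨t, _, ht⟩ := hA.exists_isClosed_box_mem h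
  ⟨t.app s, hA.box_app_mem hA.intTheory_justTheorems (axioms_subset_justTheorems A) ht s⟩

theorem directedOn_image2_box {X : Set JForm}
    (hX : DirectedOn (Pol.F.Entails (justTheorems A)) X) :
    DirectedOn (Pol.F.Entails (justTheorems A)) (Set.image2 box Set.univ X) := by
  rintro _ ⟨t, -, α, hα, rfl⟩ _ ⟨s, -, β, hβ, rfl⟩
  obtain ⟨γ, hγ, hαγ, hβγ⟩ := hX α hα β hβ
  obtain ⟨t', ht'⟩ := hA.exists_box_imp_box_mem hαγ t
  obtain ⟨s', hs'⟩ := hA.exists_box_imp_box_mem hβγ s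
  have hT := hA.intTheory_justTheorems
  have hAT := axioms_subset_justTheorems A
  exact ⟨box (t'.sum s') γ, ⟨_, Set.mem_univ _, γ, hγ, rfl⟩,
    hT.imp_trans ht' (hAT (hA.box_sum_left_mem t' s' γ)),
    hT.imp_trans hs' (hAT (hA.box_sum_right_mem t' s' γ))⟩

end JustSystem

namespace Convertible

theorem of_entails (hA : JustSystem A) (h : Convertible A s φ χ')
    (hχ : s.Entails (justTheorems A) χ χ') : Convertible A s φ χ := by
  obtain ⟨σ, hσ, γ, hγ, hχ'⟩ := h
  exact ⟨σ, hσ, γ, hγ, (hA.entails_tsubst σ hχ).trans hA.intTheory_justTheorems hχ'⟩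

theorem bot (hA : JustSystem A) (s : Pol) : Convertible A s .bot .bot :=
  ⟨_, .nil, .bot, rfl, s.entails_refl hA.intTheory_justTheorems _⟩

theorem var (hA : JustSystem A) (s : Pol) (p : ℕ) : Convertible A s (.var p) (.var p) :=
  ⟨_, .nil, .var p, rfl, s.entails_refl hA.intTheory_justTheorems _⟩

/- Each of the two substitutions leaves the indices of the other formula alone, so that it may
also be applied to the conversion of that formula. -/
theorem exists_common_subst (hA : JustSystem A) (hφ : Convertible A s₁ φ α)
    (hψ : Convertible A s₂ ψ β) (hd : φ.modalities.Disjoint ψ.modalities) :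
    ∃ ρ, LivesOn ρ (φ.modalities ++ ψ.modalities) ∧
      (∃ γ ∈ realizations s₁ φ, s₁.Entails (justTheorems A) (α.tsubst ρ) γ) ∧
      ∃ δ ∈ realizations s₂ ψ, s₂.Entails (justTheorems A) (β.tsubst ρ) δ := by
  obtain ⟨σ, hσ, γ, hγ, hαγ⟩ := hφ
  obtain ⟨τ, hτ, δ, hδ, hβδ⟩ := hψ
  refine ⟨termComp σ τ, hσ.comp hτ hd, ⟨γ.tsubst τ, ?_, ?_⟩, δ.tsubst σ, ?_, ?_⟩
  · exact tsubst_mem_realizations (fun n hn => hτ.eq_var n (hd hn)) hγ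
  · rw [← tsubst_tsubst]
    exact hA.entails_tsubst τ hαγ
  · exact tsubst_mem_realizations (fun n hn => hσ.eq_var n (hd.symm hn)) hδ
  · rw [← hσ.termComp_comm hτ hd, ← tsubst_tsubst]
    exact hA.entails_tsubst σ hβδ

theorem and (hA : JustSystem A) (hφ : Convertible A s φ α) (hψ : Convertible A s ψ β)
    (hd : φ.modalities.Disjoint ψ.modalities) : Convertible A s (φ.and ψ) (α.and β) := by
  obtain ⟨ρ, hρ, ⟨γ, hγ, hαγ⟩, δ, hδ, hβδ⟩ := hφ.exists_common_subst hA hψ hd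
  exact ⟨ρ, hρ, γ.and δ, ⟨γ, hγ, δ, hδ, rfl⟩, hαγ.and hA.intTheory_justTheorems hβδ⟩

theorem or (hA : JustSystem A) (hφ : Convertible A s φ α) (hψ : Convertible A s ψ β)
    (hd : φ.modalities.Disjoint ψ.modalities) : Convertible A s (φ.or ψ) (α.or β) := by
  obtain ⟨ρ, hρ, ⟨γ, hγ, hαγ⟩, δ, hδ, hβδ⟩ := hφ.exists_common_subst hA hψ hd
  exact ⟨ρ, hρ, γ.or δ, ⟨γ, hγ, δ, hδ, rfl⟩, hαγ.or hA.intTheory_justTheorems hβδ⟩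

theorem imp (hA : JustSystem A) (hφ : Convertible A s.flip φ α) (hψ : Convertible A s ψ β)
    (hd : φ.modalities.Disjoint ψ.modalities) : Convertible A s (φ.imp ψ) (α.imp β) := by
  obtain ⟨ρ, hρ, ⟨γ, hγ, hαγ⟩, δ, hδ, hβδ⟩ := hφ.exists_common_subst hA hψ hd
  exact ⟨ρ, hρ, γ.imp δ, ⟨γ, hγ, δ, hδ, rfl⟩, hαγ.imp hA.intTheory_justTheorems hβδ⟩

theorem box_F (hA : JustSystem A) (hφ : Convertible A .F φ α) (n : ℕ) (t : JTerm) :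
    Convertible A .F (.box n φ) (.box t α) := by
  obtain ⟨σ, hσ, γ, hγ, hαγ⟩ := hφ
  obtain ⟨u, hu⟩ := hA.exists_box_imp_box_mem hαγ (t.subst σ)
  exact ⟨σ, hσ.mono (List.subset_cons_self n _), _, ⟨γ, hγ, u, rfl⟩, hu⟩

/- With `u` closed and `u : (γ → β)`, the formula `x_n : γ` implies `(u · x_n) : β`. -/
theorem box_T (hA : JustSystem A) {n : ℕ} {Y : Set JForm} (hY : Y.Finite)
    (hYα : ∀ β ∈ Y, Pol.T.Entails (justTheorems A) β α) (hφ : Convertible A .T φ α)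
    (hn : n ∉ φ.modalities) (hχ : CombClosure .T (Form.box (.var n) '' Y) χ) :
    Convertible A .T (.box n φ) χ := by
  have hT := hA.intTheory_justTheorems
  obtain ⟨σ, hσ, γ, hγ, hγα⟩ := hφ
  have hYγ : (fun β => γ.imp (β.tsubst σ)) '' Y ⊆ justTheorems A := Set.image_subset_iff.2
    fun β hβ => hT.imp_trans hγα (hA.tsubst_mem σ (hYα β hβ))
  obtain ⟨u, hu, huY⟩ := hA.exists_isClosed_forall_box_mem (hY.image _) hYγ
  let τ := Function.update JTerm.var n (u.app (.var n))
  have hτ : LivesOn τ [n] := .update fun ρ hρ => by rw [JTerm.subst, JTerm.subst, hu, hρ]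
  have hd : φ.modalities.Disjoint [n] := List.disjoint_singleton.2 hn
  have hρn : termComp σ τ n = u.app (.var n) := by
    rw [termComp, hσ.eq_var n hn, JTerm.subst]
    exact Function.update_self ..
  refine ⟨termComp σ τ, (hσ.comp hτ hd).mono ?_, .box (.var n) (γ.tsubst τ), ⟨_, ?_, rfl⟩,
    (hχ.tsubst (termComp σ τ)).entails hT ?_⟩
  · exact fun m hm => (List.perm_append_singleton n _).subset hm
  · exact tsubst_mem_realizations (fun m hm => hτ.eq_var m (hd hm)) hγ
  · rintro _ ⟨_, ⟨β, hβ, rfl⟩, rfl⟩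
    have hbox : Form.box (u.subst τ) ((γ.tsubst τ).imp ((β.tsubst σ).tsubst τ)) ∈
        justTheorems A := hA.tsubst_mem τ (huY _ ⟨β, hβ, rfl⟩)
    rw [hu, tsubst_tsubst] at hbox
    rw [Form.tsubst, Form.map, JTerm.subst, hρn]
    exact hA.box_app_mem hT (axioms_subset_justTheorems A) hbox (.var n)

end Convertible

theorem JustSystem.convertible (hA : JustSystem A) (hφ : φ.modalities.Nodup)
    (hχ : χ ∈ quasiRealizations s φ) : Convertible A s φ χ := by
  have hT := hA.intTheory_justTheorems
  have hdir := quasiRealizations_directedOn hT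
  induction φ generalizing s χ with
  | bot =>
    obtain ⟨_, rfl, h⟩ := CombClosure.exists_entails hT (directedOn_entails_singleton hT s _) hχ
    exact (Convertible.bot hA s).of_entails hA h
  | var p =>
    obtain ⟨_, rfl, h⟩ := CombClosure.exists_entails hT (directedOn_entails_singleton hT s _) hχ
    exact (Convertible.var hA s p).of_entails hA h
  | and φ ψ ih₁ ih₂ =>
    obtain ⟨hnφ, hnψ, hd⟩ := List.nodup_append'.1 hφ
    obtain ⟨_, ⟨α, hα, β, hβ, rfl⟩, h⟩ := CombClosure.exists_entails hT
      (directedOn_entails_image2 (.and hT) (hdir s φ) (hdir s ψ)) hχ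
    exact ((ih₁ hnφ hα).and hA (ih₂ hnψ hβ) hd).of_entails hA h
  | or φ ψ ih₁ ih₂ =>
    obtain ⟨hnφ, hnψ, hd⟩ := List.nodup_append'.1 hφ
    obtain ⟨_, ⟨α, hα, β, hβ, rfl⟩, h⟩ := CombClosure.exists_entails hT
      (directedOn_entails_image2 (.or hT) (hdir s φ) (hdir s ψ)) hχ
    exact ((ih₁ hnφ hα).or hA (ih₂ hnψ hβ) hd).of_entails hA h
  | imp φ ψ ih₁ ih₂ =>
    obtain ⟨hnφ, hnψ, hd⟩ := List.nodup_append'.1 hφ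
    obtain ⟨_, ⟨α, hα, β, hβ, rfl⟩, h⟩ := CombClosure.exists_entails hT
      (directedOn_entails_image2 (.imp hT) (hdir s.flip φ) (hdir s ψ)) hχ
    exact ((ih₁ hnφ hα).imp hA (ih₂ hnψ hβ) hd).of_entails hA h
  | box n φ ih =>
    obtain ⟨hn, hnφ⟩ := List.nodup_cons.1 hφ
    cases s with
    | T =>
      obtain ⟨Y, hYφ, hY, hχY⟩ := CombClosure.exists_finite_image hχ
      obtain ⟨α, hα, hYα⟩ :=
        exists_forall_entails hT (hdir .T φ) (quasiRealizations_nonempty .T φ) hY hYφ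
      exact (ih hnφ hα).box_T hA hY hYα hn hχY
    | F =>
      obtain ⟨_, ⟨t, -, α, hα, rfl⟩, h⟩ :=
        CombClosure.exists_entails hT (hA.directedOn_image2_box (hdir .F φ)) hχ
      exact ((ih hnφ hα).box_F hA n t).of_entails hA h

end Conversion

/-! ### Realization -/

/-- The unique annotation that numbers the boxes from left to right, starting with `k`. -/
def annotate : ℕ → ModalForm → AnnForm
  | _, .bot => .bot
  | _, .var p => .var p
  | k, .and φ ψ => .and (annotate k φ) (annotate (k + φ.modalities.length) ψ)
  | k, .or φ ψ => .or (annotate k φ) (annotate (k + φ.modalities.length) ψ)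
  | k, .imp φ ψ => .imp (annotate k φ) (annotate (k + φ.modalities.length) ψ)
  | k, .box _ φ => .box k (annotate (k + 1) φ)

theorem erase_annotate (k : ℕ) (φ : ModalForm) : (annotate k φ).erase = φ := by
  induction φ generalizing k with simp_all only [Form.erase, annotate, Form.map]

theorem modalities_annotate (k : ℕ) (φ : ModalForm) :
    (annotate k φ).modalities = List.range' k φ.modalities.length := by
  induction φ generalizing k with
  | bot => rfl
  | var p => rfl
  | box _ φ ih => simp only [annotate, modalities, ih, List.length_cons, List.range'_succ]
  | and φ ψ ih₁ ih₂ | or φ ψ ih₁ ih₂ | imp φ ψ ih₁ ih₂ =>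
    simp only [annotate, modalities, ih₁, ih₂, List.length_append, List.range'_append_1]

theorem isUniqueAnnotation_annotate (k : ℕ) (φ : ModalForm) :
    IsUniqueAnnotation φ (annotate k φ) :=
  ⟨erase_annotate k φ, modalities_annotate k φ ▸ List.nodup_range'⟩

theorem JustSystem.realizes {A : Set JForm} (hA : JustSystem A) {S : Set ModalForm}
    (hS : S ⊆ frameLogic (World.Rel (A := A))) : Realizes (justLogic A) S := by
  intro φ hφ
  have realize : ∀ φ' : AnnForm, IsUniqueAnnotation φ φ' →
      ∃ ψ ∈ justLogic A, ψ ∈ realizations Pol.F φ' := by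
    rintro φ' ⟨rfl, hnd⟩
    obtain ⟨χ, hχ, hχA⟩ := hA.exists_quasiRealization_mem (hS hφ)
    obtain ⟨σ, -, γ, hγ, hχγ⟩ := hA.convertible hnd hχ
    exact ⟨γ, hA.justTheorems_subset_justLogic
      (hA.intTheory_justTheorems.mp hχγ (hA.tsubst_mem σ hχA)), hγ⟩
  have hann := isUniqueAnnotation_annotate 0 φ
  obtain ⟨ψ, hψ, hψφ⟩ := realize _ hann
  exact ⟨⟨ψ, hψ, _, hann, hψφ⟩, realize⟩

theorem justSystem_J {L : Set PropForm} (hL : IPC ⊆ L) :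
    JustSystem (substClosure L ∪ AxJ ∪ AxSum) where
  toIntSystem := (intSystem_substClosure hL).mono fun _ h => Or.inl (Or.inl h)
  application _ h := Or.inl (Or.inr h)
  sum _ h := Or.inr h
  tsubst := ((TSubstClosed.substClosure L).union .axJ).union .axSum

theorem JustSystem.union {A B : Set JForm} (hA : JustSystem A) (hB : TSubstClosed B) :
    JustSystem (A ∪ B) where
  toIntSystem := hA.toIntSystem.mono Set.subset_union_left
  application := hA.application.trans Set.subset_union_left
  sum := hA.sum.trans Set.subset_union_left
  tsubst := hA.tsubst.union hB

/-- The propositional logic `L` extends `IPC` and is valid in the canonical frame of every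
justification logic whose axioms contain all substitution instances of `L`. -/
structure IsCanonical (L : Set PropForm) : Prop where
  IPC_subset : IPC ⊆ L
  valid : ∀ A : Set JForm, substClosure L ⊆ A → L ⊆ propFrameLogic (World.Rel (A := A))

namespace IsCanonical

variable {L : Set PropForm}

theorem modalK_subset (hL : IsCanonical L) {A : Set JForm} (hA : substClosure L ⊆ A) :
    modalK L ⊆ frameLogic (World.Rel (A := A)) :=
  modalK_subset_frameLogic World.antitone_rel (hL.valid A hA)

theorem realizes_K (hL : IsCanonical L) : Realizes (justJ L) (modalK L) :=
  (justSystem_J hL.IPC_subset).realizes (hL.modalK_subset fun _ h => Or.inl (Or.inl h))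

theorem realizes_T (hL : IsCanonical L) : Realizes (justJT L) (modalT L) :=
  ((justSystem_J hL.IPC_subset).union .axF).realizes <|
    oplus_subset_frameLogic World.antitone_rel
      (hL.modalK_subset fun _ h => Or.inl (Or.inl (Or.inl h)))
      (AxT_subset_frameLogic (World.rel_refl Set.subset_union_right))

theorem realizes_K4 (hL : IsCanonical L) : Realizes (justJ4 L) (modalK4 L) :=
  ((justSystem_J hL.IPC_subset).union .axI).realizes <|
    oplus_subset_frameLogic World.antitone_rel
      (hL.modalK_subset fun _ h => Or.inl (Or.inl (Or.inl h)))
      (Ax4_subset_frameLogic (World.rel_trans Set.subset_union_right))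

theorem realizes_S4 (hL : IsCanonical L) : Realizes (justJT4 L) (modalS4 L) :=
  (((justSystem_J hL.IPC_subset).union .axF).union .axI).realizes <|
    oplus_subset_frameLogic World.antitone_rel
      (oplus_subset_frameLogic World.antitone_rel
        (hL.modalK_subset fun _ h => Or.inl (Or.inl (Or.inl (Or.inl h))))
        (AxT_subset_frameLogic (World.rel_refl fun _ h => Or.inl (Or.inr h))))
      (Ax4_subset_frameLogic (World.rel_trans Set.subset_union_right))

end IsCanonical

theorem substClosure_mono {L L' : Set PropForm} (h : L ⊆ L') :
    substClosure L ⊆ substClosure L' := by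
  rintro _ ⟨φ, σ, hφ, rfl⟩
  exact ⟨φ, σ, h hφ, rfl⟩

theorem subset_plus_left {M : Type} (Γ Δ : Set (Form M)) : Γ ⊆ plus Γ Δ :=
  fun _ h => .base (Or.inl h)

theorem subset_plus_right {M : Type} (Γ Δ : Set (Form M)) : Δ ⊆ plus Γ Δ :=
  fun _ h => .base (Or.inr h)

theorem isCanonical_Gn (n : ℕ) : IsCanonical (Gn n) where
  IPC_subset := (subset_plus_left IPC LIN).trans (subset_plus_left G _)
  valid A hA := by
    have hlin : substClosure LIN ⊆ A :=
      (substClosure_mono ((subset_plus_right IPC LIN).trans (subset_plus_left G _))).trans hA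
    have hBC : substClosure (BC (n - 1)) ⊆ A :=
      (substClosure_mono (subset_plus_right G _)).trans hA
    have hR := World.antitone_rel (A := A)
    exact plus_subset_propFrameLogic
      (plus_subset_propFrameLogic (IPC_subset_propFrameLogic hR)
        (LIN_subset_propFrameLogic hR (World.isChain_Ici hlin)))
      (BC_subset_propFrameLogic hR (World.isChain_Ici hlin) (World.not_strictMono hBC))

theorem isCanonical_KC : IsCanonical KC where
  IPC_subset := subset_plus_left IPC WLEM
  valid A hA := by
    have hWLEM := (substClosure_mono (subset_plus_right IPC WLEM)).trans hA
    have hR := World.antitone_rel (A := A)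
    exact plus_subset_propFrameLogic (IPC_subset_propFrameLogic hR)
      (WLEM_subset_propFrameLogic hR (World.directedOn_Ici hWLEM))

end InterJust

theorem mainTheorem12 :
    (∀ n : ℕ, 2 ≤ n →
      Realizes (justJ (Gn n)) (modalK (Gn n)) ∧
      Realizes (justJT (Gn n)) (modalT (Gn n)) ∧
      Realizes (justJ4 (Gn n)) (modalK4 (Gn n)) ∧
      Realizes (justJT4 (Gn n)) (modalS4 (Gn n))) ∧
    (Realizes (justJ KC) (modalK KC) ∧
      Realizes (justJT KC) (modalT KC) ∧
      Realizes (justJ4 KC) (modalK4 KC) ∧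
      Realizes (justJT4 KC) (modalS4 KC)) := by
  refine ⟨fun n _ => ?_, ?_⟩
  · have hGn := isCanonical_Gn n
    exact ⟨hGn.realizes_K, hGn.realizes_T, hGn.realizes_K4, hGn.realizes_S4⟩
  · have hKC := isCanonical_KC
    exact ⟨hKC.realizes_K, hKC.realizes_T, hKC.realizes_K4, hKC.realizes_S4⟩
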